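/- Let $G$ be a connected non-compact Lie group whose Lie algebra $\mathfrak g$ is simple, with Killing form $B$, and let $\mathfrak g=\mathfrak p\oplus\mathfrak k$ be a Cartan decomposition: $\mathfrak k$ is a subalgebra, $\mathfrak p$ is its $B$-orthogonal complement, $[\mathfrak p,\mathfrak p]\subset\mathfrak k$, and $B$ is positive definite on $\mathfrak p$ and negative definite on $\mathfrak k$. (If the centre of $G$ is finite, these are the decompositions in which $\mathfrak k$ is the Lie algebra of a maximal compact subgroup $K$ of $G$.) Let $Q=B|_{\mathfrak p}-B|_{\mathfrak k}$ and $n=\dim\mathfrak p$. Let $\mathfrak k_1,\dots,\mathfrak k_r$ be the distinct simple ideals of $[\mathfrak k,\mathfrak k]$; put $s=0$ if the centre of $\mathfrak k$ is trivial, and otherwise put $s=1$ and let $\mathfrak k_{r+1}$ be the centre of $\mathfrak k$. Let $d_i=\dim\mathfrak k_i$ and let $B_i$ be the Killing form of $\mathfrak k_i$. Then: (a) for each $i=1,\dots,r+s$ there is a unique $\kappa_i\in\mathbb R$ with $B_i=\kappa_i\,B|_{\mathfrak k_i}$; (b) $2\sum_{i=1}^{r+s}d_i(1-\kappa_i)=n$;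 (c) if $\beta,\alpha_1,\dots,\alpha_{r+s}>0$ and $g$ is the left-invariant Riemannian metric on $G$ which on $\mathfrak g=T_eG$ is $$g=\beta\,Q|_{\mathfrak p}+\alpha_1\,Q|_{\mathfrak k_1}+\dots+\alpha_{r+s}\,Q|_{\mathfrak k_{r+s}}$$ (with $\mathfrak p,\mathfrak k_1,\dots,\mathfrak k_{r+s}$ pairwise $g$-orthogonal), then the scalar curvature of $g$ is, at every point of $G$, $$S(g)=-\frac14\sum_{i=1}^{r+s}\frac{\alpha_i}{\beta^2}\,d_i(1-\kappa_i)-\frac{n}{2\beta}+\frac14\sum_{i=1}^{r}\frac{d_i\kappa_i}{\alpha_i}.$$ -/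

import Mathlib

open scoped Manifold ContDiff Bundle

/-! ### Smoothness bookkeeping -/

/-- Over `ℝ`, a `C^∞` Lie group has the regularity under which Mathlib builds its Lie algebra. -/
instance leInfty_minSmoothness_three : ENat.LEInfty (minSmoothness ℝ 3) where
  out := by
    rw [minSmoothness_of_isRCLikeNormedField]
    exact ENat.LEInfty.out

/-! ### Levi-Civita connection and scalar curvature of a Riemannian manifold -/

section Riemannian

variable {E : Type*} [NormedAddCommGroup E] [NormedSpace ℝ E] [FiniteDimensional ℝ E]
  {H : Type*} [TopologicalSpace H] {I : ModelWithCorners ℝ E H}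
  {M : Type*} [TopologicalSpace M] [ChartedSpace H M] [IsManifold I ∞ M]

/-- A smooth vector field on `M`. -/
def IsSmoothVectorField (X : Π x : M, TangentSpace I x) : Prop :=
  ContMDiff I I.tangent ∞ (fun x => (⟨x, X x⟩ : TangentBundle I M))

/-- `∇` is the Levi-Civita connection of the Riemannian metric `g`: it is torsion-free and
`X (g(Y, Z)) = g(∇_X Y, Z) + g(Y, ∇_X Z)`. In Mathlib, `(∇_X Y) x` is written `nabla Y x (X x)`. -/
structure IsLeviCivita
    (g : Bundle.ContMDiffRiemannianMetric I ∞ E (TangentSpace I : M → Type _))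
    (nabla : CovariantDerivative I E (TangentSpace I : M → Type _)) : Prop where
  torsion_free : ∀ (X Y : Π x : M, TangentSpace I x),
    IsSmoothVectorField X → IsSmoothVectorField Y →
    ∀ x : M, nabla Y x (X x) - nabla X x (Y x) = VectorField.mlieBracket I X Y x
  metric : ∀ (X Y Z : Π x : M, TangentSpace I x),
    IsSmoothVectorField X → IsSmoothVectorField Y → IsSmoothVectorField Z →
    ∀ x : M, mfderiv I 𝓘(ℝ, ℝ) (fun y => g.inner y (Y y) (Z y)) x (X x)
      = g.inner x (nabla Y x (X x)) (Z x) + g.inner x (Y x) (nabla Z x (X x))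

/-- The curvature `R(X, Y) Z = ∇_X ∇_Y Z - ∇_Y ∇_X Z - ∇_[X, Y] Z`, evaluated at `x`. -/
noncomputable def curvatureAt
    (nabla : CovariantDerivative I E (TangentSpace I : M → Type _))
    (X Y Z : Π x : M, TangentSpace I x) (x : M) : TangentSpace I x :=
  nabla (fun y => nabla Z y (Y y)) x (X x) - nabla (fun y => nabla Z y (X y)) x (Y x)
    - nabla Z x (VectorField.mlieBracket I X Y x)

/-- The scalar curvature of `(M, g)` at `x` is `s`: the metric has a Levi-Civita connection, and
`s = ∑_j Ric(e_j, e_j) = ∑_{i,j} g(R(e_i, e_j) e_j, e_i)` for every orthonormal basis `(e_i)` of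
the tangent space at `x`, the curvature being computed with arbitrary smooth vector fields
extending the `e_i`. -/
def HasScalarCurvatureAt
    (g : Bundle.ContMDiffRiemannianMetric I ∞ E (TangentSpace I : M → Type _))
    (x : M) (s : ℝ) : Prop :=
  (∃ nabla : CovariantDerivative I E (TangentSpace I : M → Type _), IsLeviCivita g nabla) ∧
  ∀ nabla : CovariantDerivative I E (TangentSpace I : M → Type _), IsLeviCivita g nabla →
    ∀ e : Fin (Module.finrank ℝ E) → Π y : M, TangentSpace I y,
      (∀ i, IsSmoothVectorField (e i)) →
      (∀ i j, g.inner x (e i x) (e j x) = if i = j then 1 else 0) →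
      s = ∑ j, ∑ i, g.inner x (curvatureAt nabla (e i) (e j) (e j) x) (e i x)

end Riemannian

/-- A Riemannian metric on a Lie group is left-invariant if all left translations are isometries. -/
def IsLeftInvariantMetric {E : Type*} [NormedAddCommGroup E] [NormedSpace ℝ E]
    {H : Type*} [TopologicalSpace H] {I : ModelWithCorners ℝ E H}
    {G : Type*} [TopologicalSpace G] [ChartedSpace H G] [Group G] [IsManifold I ∞ G]
    (g : Bundle.ContMDiffRiemannianMetric I ∞ E (TangentSpace I : G → Type _)) : Prop :=
  ∀ (a x : G) (u v : TangentSpace I x),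
    g.inner (a * x) (mfderiv I I (fun y => a * y) x u) (mfderiv I I (fun y => a * y) x v)
      = g.inner x u v

/-! ### Cartan decompositions of a real Lie algebra -/

section LieAlg

variable {L : Type*} [LieRing L] [LieAlgebra ℝ L]

/-- `L = p ⊕ k` is a Cartan decomposition: `k` is a subalgebra, `p` is its orthogonal complement
with respect to the Killing form `B`, `[p, p] ⊆ k`, and `B` is positive definite on `p` and
negative definite on `k`. (The inclusion `[k, p] ⊆ p` follows from the invariance of `B`.) -/
structure IsCartanDecomposition (k : LieSubalgebra ℝ L) (p : Submodule ℝ L) : Prop where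
  isCompl : IsCompl p k.toSubmodule
  mem_p_iff : ∀ X : L, X ∈ p ↔ ∀ Z ∈ k, killingForm ℝ L X Z = 0
  lie_mem : ∀ X ∈ p, ∀ Y ∈ p, ⁅X, Y⁆ ∈ k
  pos : ∀ X ∈ p, X ≠ 0 → 0 < killingForm ℝ L X X
  neg : ∀ Z ∈ k, Z ≠ 0 → killingForm ℝ L Z Z < 0

/-- The form `Q = B|_p - B|_k` attached to a decomposition `L = p ⊕ k`, i.e.
`Q(X, Y) = B(X_p, Y_p) - B(X_k, Y_k)`. -/
noncomputable def cartanForm {k : LieSubalgebra ℝ L} {p : Submodule ℝ L}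
    (h : IsCartanDecomposition k p) (X Y : L) : ℝ :=
  killingForm ℝ L (p.projectionOnto k.toSubmodule h.isCompl X)
      (p.projectionOnto k.toSubmodule h.isCompl Y)
    - killingForm ℝ L (k.toSubmodule.projectionOnto p h.isCompl.symm X)
        (k.toSubmodule.projectionOnto p h.isCompl.symm Y)

/-- The derived algebra `[k, k]`, as a subalgebra of `L`. -/
noncomputable def derivedSub (k : LieSubalgebra ℝ L) : LieSubalgebra ℝ L :=
  LieSubalgebra.map k.incl
    (LieIdeal.toLieSubalgebra ℝ k ⁅(⊤ : LieIdeal ℝ k), (⊤ : LieIdeal ℝ k)⁆)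

/-- The centre of `k`, as a subalgebra of `L`. -/
noncomputable def centerSub (k : LieSubalgebra ℝ L) : LieSubalgebra ℝ L :=
  LieSubalgebra.map k.incl (LieIdeal.toLieSubalgebra ℝ k (LieAlgebra.center ℝ k))

/-- `h` is a simple ideal of `D` (both are subalgebras of `L`). -/
def IsSimpleIdealOf (h D : LieSubalgebra ℝ L) : Prop :=
  h ≤ D ∧ (∀ X ∈ D, ∀ Y ∈ h, ⁅X, Y⁆ ∈ h) ∧ LieAlgebra.IsSimple ℝ h

/-- `k_1, …, k_{r+s}` are the standard ideals of `k`: the first `r` enumerate without repetition the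
simple ideals of `[k, k]`; if the centre of `k` is trivial then `s = 0`, otherwise `s = 1` and
`k_{r+1}` is the centre. -/
structure IsStandardIdeals (k : LieSubalgebra ℝ L) (r s : ℕ)
    (kk : Fin (r + s) → LieSubalgebra ℝ L) : Prop where
  injective : Function.Injective (fun i : Fin r => kk (Fin.castAdd s i))
  simple_iff : ∀ h : LieSubalgebra ℝ L,
    IsSimpleIdealOf h (derivedSub k) ↔ ∃ i : Fin r, kk (Fin.castAdd s i) = h
  card_center : (centerSub k = ⊥ ∧ s = 0) ∨ (centerSub k ≠ ⊥ ∧ s = 1)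
  center : ∀ j : Fin s, kk (Fin.natAdd r j) = centerSub k

/-- `B_h = κ B|_h`, where `B_h` is the Killing form of the subalgebra `h` and `B` that of `L`. -/
def IsKillingRatio (h : LieSubalgebra ℝ L) (κ : ℝ) : Prop :=
  ∀ X Y : h, killingForm ℝ h X Y = κ * killingForm ℝ L (X : L) (Y : L)

/-- The form `b` on `L` equals `β Q|_p + ∑ᵢ αᵢ Q|_{k_i}`: it is `β Q` on `p` and `αᵢ Q` on `k_i`,
and the subspaces `p, k_1, …, k_m` (whose sum is `L`) are pairwise `b`-orthogonal. -/
structure IsBlockForm {k : LieSubalgebra ℝ L} {p : Submodule ℝ L}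
    (h : IsCartanDecomposition k p) {m : ℕ} (kk : Fin m → LieSubalgebra ℝ L)
    (β : ℝ) (α : Fin m → ℝ) (b : L → L → ℝ) : Prop where
  on_p : ∀ X ∈ p, ∀ Y ∈ p, b X Y = β * cartanForm h X Y
  on_k : ∀ i, ∀ X ∈ kk i, ∀ Y ∈ kk i, b X Y = α i * cartanForm h X Y
  p_k : ∀ i, ∀ X ∈ p, ∀ Y ∈ kk i, b X Y = 0
  k_k : ∀ i j, i ≠ j → ∀ X ∈ kk i, ∀ Y ∈ kk j, b X Y = 0

end LieAlg

/-! The proof reduces curvature to structure constants, and these to traces of the Killing form `B`.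

Geometry. Left-invariant fields extending a `g`-orthonormal basis `e` of the Lie algebra form a
global orthonormal frame with constant bracket coefficients `C i j l = g([e_i, e_j], e_l)`. The
Koszul formula then forces constant Christoffel symbols, which gives existence and uniqueness of the
Levi-Civita connection on smooth fields. Its curvature depends only on values at the point, and its
double trace does not depend on the orthonormal basis. If all `ad e_j` are traceless, `S = -1/4 ∑
C_ijl² - 1/2 ∑ C_ijl C_ilj` (`IsHomogeneousFrame.hasScalarCurvatureAt`).

Algebra. `[k, k]` is semisimple and its `B`-orthogonal complement in `k` is the centre, so `k` is
the orthogonal sum of the `k_i`. Take a `B`-orthonormal basis `z` with signs `ε` adapted to `p` and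
the `k_i`. The squares `T_abc = B([z_a, z_b], z_c)²` are totally symmetric and live only on types
`(p, p, k_i)` and `(k_i, k_i, k_i)`. Writing `B(z_a, z_a)` as the trace of `(ad z_a)²` gives `∑_bc
ε_b ε_c T_abc = -ε_a`; the same computation inside `k_i` gives `∑ T = κ_i`. So for `z_a` in `k_i`
the sum over `p × p` is `1 - κ_i`, while for `z_a` in `p` twice the sum over `k × p` is `1`.
Counting the `(k, p, p)` triples both ways is (b).

For (c), put `e_a = z_a / √w_a`, with `w = β` on `p` and `w = α_i` on `k_i`. Then `C_abc² = w_c /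
(w_a w_b) T_abc`, while in `C_abc C_acb` the weights of `b` and `c` cancel and the sum over them is
`ε_a / w_a`. Both sums follow from the identities above.

Part (a) is a Schur argument: an eigenspace of the Killing form of `k_i` relative to the definite
form `B` is a non-zero ideal of the simple algebra `k_i`. On the centre the ratio is `0`. -/

set_option linter.unusedSectionVars false

/-! ### Levi-Civita connection of a frame with constant structure coefficients. -/

section Frame

variable {E : Type*} [NormedAddCommGroup E] [NormedSpace ℝ E] [FiniteDimensional ℝ E]
  {H : Type*} [TopologicalSpace H] {I : ModelWithCorners ℝ E H}
  {M : Type*} [TopologicalSpace M] [ChartedSpace H M] [IsManifold I ∞ M]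
  {ι : Type*} [Fintype ι] [DecidableEq ι]

/-- A global smooth orthonormal frame whose Lie brackets have constant coefficients. -/
structure IsHomogeneousFrame
    (g : Bundle.ContMDiffRiemannianMetric I ∞ E (TangentSpace I : M → Type _))
    (F : ι → Π x : M, TangentSpace I x) (C : ι → ι → ι → ℝ) : Prop where
  smooth : ∀ i, IsSmoothVectorField (F i)
  orthonormal : ∀ x i j, g.inner x (F i x) (F j x) = if i = j then 1 else 0
  expansion : ∀ x (v : TangentSpace I x), v = ∑ i, g.inner x v (F i x) • F i x
  bracket : ∀ x i j, VectorField.mlieBracket I (F i) (F j) x = ∑ k, C i j k • F k x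

/-- The Christoffel symbols of a homogeneous orthonormal frame. -/
noncomputable def frameChristoffel (C : ι → ι → ι → ℝ) (i j k : ι) : ℝ :=
  (C i j k - C j k i + C k i j) / 2

theorem isSmoothVectorField_iff_section {X : Π x : M, TangentSpace I x} :
    IsSmoothVectorField X ↔ CMDiff ∞ (T% X) := Iff.rfl

theorem IsSmoothVectorField.mdifferentiable {X : Π x : M, TangentSpace I x}
    (hX : IsSmoothVectorField X) : MDiff (T% X) :=
  ContMDiff.mdifferentiable (isSmoothVectorField_iff_section.1 hX) (by simp)

theorem contMDiff_metric (g : Bundle.ContMDiffRiemannianMetric I ∞ E (TangentSpace I : M → Type _))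
    {X Y : Π x : M, TangentSpace I x} (hX : IsSmoothVectorField X) (hY : IsSmoothVectorField Y) :
    ContMDiff I 𝓘(ℝ, ℝ) ∞ (fun x => g.inner x (X x) (Y x)) := by
  let _ : Bundle.RiemannianBundle (TangentSpace I : M → Type _) := ⟨g.toRiemannianMetric⟩
  exact ContMDiff.inner_bundle (IB := I) (n := ∞) (F := E)
    (E := (TangentSpace I : M → Type _)) (b := fun x => x) (v := X) (w := Y)
    hX hY

theorem mdifferentiableAt_metric
    (g : Bundle.ContMDiffRiemannianMetric I ∞ E (TangentSpace I : M → Type _))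
    {X Y : Π x : M, TangentSpace I x} {x : M} (hX : MDiffAt (T% X) x) (hY : MDiffAt (T% Y) x) :
    MDifferentiableAt I 𝓘(ℝ, ℝ) (fun x => g.inner x (X x) (Y x)) x := by
  let _ : Bundle.RiemannianBundle (TangentSpace I : M → Type _) := ⟨g.toRiemannianMetric⟩
  have : IsContMDiffRiemannianBundle I 1 E (TangentSpace I : M → Type _) := 
    IsContMDiffRiemannianBundle.of_le (n := ∞) (by simp)
  exact MDifferentiableAt.inner_bundle (IB := I) (F := E)
    (E := (TangentSpace I : M → Type _)) (b := fun x => x) (v := X) (w := Y)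
    hX hY

theorem IsSmoothVectorField.smul {f : M → ℝ} {X : Π x : M, TangentSpace I x}
    (hf : ContMDiff I 𝓘(ℝ, ℝ) ∞ f) (hX : IsSmoothVectorField X) : IsSmoothVectorField (f • X) :=
  ContMDiff.smul_section hf hX

theorem IsSmoothVectorField.sum {s : Finset ι} {X : ι → Π x : M, TangentSpace I x}
    (hX : ∀ i, IsSmoothVectorField (X i)) : 
    IsSmoothVectorField (fun x => ∑ i ∈ s, X i x) :=
  ContMDiff.sum_section (fun i _ => hX i)

theorem IsSmoothVectorField.mlieBracket {X Y : Π x : M, TangentSpace I x}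
    (hX : IsSmoothVectorField X) (hY : IsSmoothVectorField Y) :
    IsSmoothVectorField (VectorField.mlieBracket I X Y) := by
  have : IsManifold I (((⊤ : ℕ∞) : WithTop ℕ∞) + 1) M := ‹IsManifold I ∞ M›
  exact ContDiff.mlieBracket_vectorField (m := ⊤) (n := ⊤) hX hY
    (by rw [minSmoothness_of_isRCLikeNormedField]; rfl)

theorem mlieBracket_smul_right_eq {Y W : Π x : M, TangentSpace I x} {f : M → ℝ}
    (hW : IsSmoothVectorField W) (hf : ContMDiff I 𝓘(ℝ, ℝ) ∞ f) :
    VectorField.mlieBracket I Y (f • W) =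
      (fun y => mvfderiv I f y (Y y)) • W + f • VectorField.mlieBracket I Y W := by
  funext y
  exact VectorField.mlieBracket_smul_right (hf.mdifferentiable (by simp) y) (hW.mdifferentiable y)

/-- Smooth vector fields act on smooth functions by `[X, Y] f = X (Y f) - Y (X f)`. -/
theorem mvfderiv_mlieBracket {X Y W : Π x : M, TangentSpace I x} {f : M → ℝ} {x : M}
    (hX : IsSmoothVectorField X) (hY : IsSmoothVectorField Y) (hW : IsSmoothVectorField W)
    (hWx : W x ≠ 0) (hf : ContMDiff I 𝓘(ℝ, ℝ) ∞ f)
    (hXf : ContMDiff I 𝓘(ℝ, ℝ) ∞ (fun y => mvfderiv I f y (X y)))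
    (hYf : ContMDiff I 𝓘(ℝ, ℝ) ∞ (fun y => mvfderiv I f y (Y y))) :
    mvfderiv I f x (VectorField.mlieBracket I X Y x) =
      mvfderiv I (fun y => mvfderiv I f y (Y y)) x (X x)
        - mvfderiv I (fun y => mvfderiv I f y (X y)) x (Y x) := by
  have : IsManifold I (minSmoothness ℝ 3) M := IsManifold.of_le (n := ∞) ENat.LEInfty.out
  have h2 : minSmoothness ℝ 2 ≤ ∞ := by
    rw [minSmoothness_of_isRCLikeNormedField]; exact ENat.LEInfty.out
  -- Expand the Jacobi identity for `X`, `Y`, `f W` by the Leibniz rule. Modulo the Jacobi identity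
  -- for `X`, `Y`, `W`, only a multiple of `W` is left, and its coefficient is the wanted identity.
  have key : ∀ {U V : Π x : M, TangentSpace I x}, IsSmoothVectorField U → IsSmoothVectorField V →
      ContMDiff I 𝓘(ℝ, ℝ) ∞ (fun y => mvfderiv I f y (V y)) →
      VectorField.mlieBracket I U (VectorField.mlieBracket I V (f • W)) x =
        mvfderiv I (fun y => mvfderiv I f y (V y)) x (U x) • W x
        + mvfderiv I f x (V x) • VectorField.mlieBracket I U W x
        + (mvfderiv I f x (U x) • VectorField.mlieBracket I V W x
          + f x • VectorField.mlieBracket I U (VectorField.mlieBracket I V W) x) := by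
    intro U V hU hV hVf
    rw [mlieBracket_smul_right_eq hW hf,
      VectorField.mlieBracket_add_right ((hW.smul hVf).mdifferentiable x)
        (((hV.mlieBracket hW).smul hf).mdifferentiable x),
      mlieBracket_smul_right_eq hW hVf, mlieBracket_smul_right_eq (hV.mlieBracket hW) hf]
    rfl
  have J := VectorField.leibniz_identity_mlieBracket_apply (x := x)
    ((hX x).of_le h2) ((hY x).of_le h2) (((hW.smul hf) x).of_le h2)
  have J' := VectorField.leibniz_identity_mlieBracket_apply (x := x)
    ((hX x).of_le h2) ((hY x).of_le h2) ((hW x).of_le h2)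
  rw [key hX hY hYf, key hY hX hXf, mlieBracket_smul_right_eq hW hf, J'] at J
  have J2 : (mvfderiv I f x (VectorField.mlieBracket I X Y x) -
      (mvfderiv I (fun y => mvfderiv I f y (Y y)) x (X x)
        - mvfderiv I (fun y => mvfderiv I f y (X y)) x (Y x))) • W x = 0 := by
    simp only [Pi.add_apply, Pi.smul_apply'] at J
    rw [← sub_eq_zero] at J
    rw [← neg_eq_zero]
    exact Eq.trans (by module) J
  rcases smul_eq_zero.1 J2 with h | h
  · exact sub_eq_zero.1 h
  · exact absurd h hWx

/-- The `k`-th coefficient of a vector field in an orthonormal frame. -/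
noncomputable def frameCoeff
    (g : Bundle.ContMDiffRiemannianMetric I ∞ E (TangentSpace I : M → Type _))
    (F : ι → Π x : M, TangentSpace I x) (X : Π x : M, TangentSpace I x) (k : ι) (x : M) : ℝ :=
  g.inner x (X x) (F k x)

section

variable {g : Bundle.ContMDiffRiemannianMetric I ∞ E (TangentSpace I : M → Type _)}
  {F : ι → Π x : M, TangentSpace I x} {C : ι → ι → ι → ℝ}

theorem IsHomogeneousFrame.contMDiff_coeff (hF : IsHomogeneousFrame g F C)
    {X : Π x : M, TangentSpace I x} (hX : IsSmoothVectorField X) (k : ι) :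
    ContMDiff I 𝓘(ℝ, ℝ) ∞ (frameCoeff g F X k) :=
  contMDiff_metric g hX (hF.smooth k)

theorem IsHomogeneousFrame.mdifferentiableAt_coeff (hF : IsHomogeneousFrame g F C)
    {X : Π x : M, TangentSpace I x} {x : M} (hX : MDiffAt (T% X) x) (k : ι) :
    MDifferentiableAt I 𝓘(ℝ, ℝ) (frameCoeff g F X k) x :=
  mdifferentiableAt_metric g hX ((hF.smooth k).mdifferentiable x)

theorem IsHomogeneousFrame.coeff_sum (hF : IsHomogeneousFrame g F C) (x : M) (a : ι → ℝ) (k : ι) :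
    g.inner x (∑ i, a i • F i x) (F k x) = a k := by
  rw [map_sum, _root_.sum_apply]
  simp [hF.orthonormal]

theorem IsHomogeneousFrame.inner_eq (hF : IsHomogeneousFrame g F C) (x : M)
    (v w : TangentSpace I x) :
    g.inner x v w = ∑ i, g.inner x v (F i x) * g.inner x w (F i x) := by
  conv_lhs => rw [hF.expansion x w]
  rw [map_sum]
  simp [mul_comm]

theorem IsHomogeneousFrame.ext (hF : IsHomogeneousFrame g F C) {x : M}
    {v w : TangentSpace I x} (h : ∀ k, g.inner x v (F k x) = g.inner x w (F k x)) : v = w := by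
  rw [hF.expansion x v, hF.expansion x w]
  simp only [h]

/-- The connection whose Christoffel symbols in a homogeneous frame are `frameChristoffel C`. -/
noncomputable def IsHomogeneousFrame.connection (hF : IsHomogeneousFrame g F C) :
    CovariantDerivative I E (TangentSpace I : M → Type _) where
  toFun Y x := ∑ k, (mvfderiv I (frameCoeff g F Y k) x +
    ∑ i, ∑ j, (frameCoeff g F Y j x * frameChristoffel C i j k) • g.inner x (F i x)).smulRight
      (F k x)
  isCovariantDerivativeOnUniv :=
    { add := by
        intro Y Y' x hY hY' _
        rw [← Finset.sum_add_distrib]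
        refine Finset.sum_congr rfl fun k _ => ?_
        have h : ∀ k, frameCoeff g F (Y + Y') k = frameCoeff g F Y k + frameCoeff g F Y' k := by
          intro k
          funext y
          simp [frameCoeff]
        simp only [h, Pi.add_apply]
        rw [mvfderiv_add (hF.mdifferentiableAt_coeff hY k) (hF.mdifferentiableAt_coeff hY' k)]
        ext v
        simp only [ContinuousLinearMap.smulRight_apply, _root_.add_apply,
          _root_.sum_apply, _root_.smul_apply, add_mul, add_smul,
          Finset.sum_add_distrib]
        module
      leibniz := by
        intro Y f x hY hf _
        have h : ∀ k, frameCoeff g F (f • Y) k = f * frameCoeff g F Y k := by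
          intro k
          funext y
          simp [frameCoeff]
        conv_rhs => rw [hF.expansion x (Y x)]
        simp only [h, Pi.mul_apply]
        ext v
        simp only [ContinuousLinearMap.smulRight_apply, _root_.add_apply,
          _root_.sum_apply, _root_.smul_apply, Finset.smul_sum]
        rw [← Finset.sum_add_distrib]
        refine Finset.sum_congr rfl fun k _ => ?_
        rw [mvfderiv_mul hf (hF.mdifferentiableAt_coeff hY k)]
        simp only [_root_.add_apply, _root_.smul_apply, smul_eq_mul,
          mul_assoc, ← Finset.mul_sum]
        simp only [smul_smul, ← add_smul, frameCoeff]
        congr 1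
        ring }

theorem IsHomogeneousFrame.coeff_connection (hF : IsHomogeneousFrame g F C)
    (Y : Π x : M, TangentSpace I x) (x : M) (v : TangentSpace I x) (k : ι) :
    g.inner x (hF.connection Y x v) (F k x) = mvfderiv I (frameCoeff g F Y k) x v +
      ∑ i, ∑ j, g.inner x v (F i x) * frameCoeff g F Y j x * frameChristoffel C i j k := by
  have : hF.connection Y x v = ∑ k, (mvfderiv I (frameCoeff g F Y k) x v +
      ∑ i, ∑ j, g.inner x v (F i x) * frameCoeff g F Y j x * frameChristoffel C i j k) • F k x := by
    simp only [IsHomogeneousFrame.connection, ContinuousLinearMap.smulRight_apply,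
      _root_.add_apply, _root_.sum_apply,
      _root_.smul_apply]
    refine Finset.sum_congr rfl fun k _ => ?_
    congr 2
    refine Finset.sum_congr rfl fun i _ => Finset.sum_congr rfl fun j _ => ?_
    rw [g.symm, smul_eq_mul]
    ring
  rw [this, hF.coeff_sum]

end

theorem mdifferentiableAt_sum_mvfderiv_sum {κ : Type*} (s : Finset κ) {f : κ → M → ℝ} {x : M}
    (hf : ∀ i, MDifferentiableAt I 𝓘(ℝ, ℝ) (f i) x) :
    MDifferentiableAt I 𝓘(ℝ, ℝ) (fun y => ∑ i ∈ s, f i y) x ∧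
      mvfderiv I (fun y => ∑ i ∈ s, f i y) x = ∑ i ∈ s, mvfderiv I (f i) x := by
  classical
  induction s using Finset.induction_on with
  | empty => exact ⟨by simpa using mdifferentiableAt_const, by simpa using mvfderiv_const 0⟩
  | insert a s ha ih =>
    simp only [Finset.sum_insert ha]
    refine ⟨(hf a).add ih.1, ?_⟩
    rw [← ih.2]
    exact mvfderiv_fun_add (hf a) ih.1

theorem mvfderiv_sum_mul_apply {κ : Type*} (s : Finset κ) {f h : κ → M → ℝ} {x : M}
    (hf : ∀ i, MDifferentiableAt I 𝓘(ℝ, ℝ) (f i) x)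
    (hh : ∀ i, MDifferentiableAt I 𝓘(ℝ, ℝ) (h i) x) (v : TangentSpace I x) :
    mvfderiv I (fun y => ∑ i ∈ s, f i y * h i y) x v =
      ∑ i ∈ s, (mvfderiv I (f i) x v * h i x + f i x * mvfderiv I (h i) x v) := by
  rw [(mdifferentiableAt_sum_mvfderiv_sum s (f := fun i y => f i y * h i y)
    (fun i => (hf i).mul (hh i))).2, _root_.sum_apply]
  refine Finset.sum_congr rfl fun i _ => ?_
  rw [mvfderiv_fun_mul (hf i) (hh i)]
  simp only [_root_.add_apply, _root_.smul_apply, smul_eq_mul]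
  ring

section

variable {g : Bundle.ContMDiffRiemannianMetric I ∞ E (TangentSpace I : M → Type _)}
  {F : ι → Π x : M, TangentSpace I x} {C : ι → ι → ι → ℝ}

/-- A point is required because over an empty manifold the frame axioms say nothing about `C`. -/
theorem IsHomogeneousFrame.antisymm [Nonempty M] (hF : IsHomogeneousFrame g F C) (i j k : ι) :
    C i j k = -C j i k := by
  obtain ⟨x⟩ := ‹Nonempty M›
  rw [← hF.coeff_sum x (C i j) k, ← hF.bracket, VectorField.mlieBracket_swap_apply, hF.bracket,
    map_neg, _root_.neg_apply, hF.coeff_sum]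

theorem IsHomogeneousFrame.coeff_connection_frame (hF : IsHomogeneousFrame g F C)
    (x : M) (i j k : ι) :
    g.inner x (hF.connection (F j) x (F i x)) (F k x) = frameChristoffel C i j k := by
  have h : ∀ k, frameCoeff g F (F j) k = fun _ => if j = k then 1 else 0 := by
    intro k
    funext y
    exact hF.orthonormal y j k
  rw [hF.coeff_connection]
  simp [h, mvfderiv_const, hF.orthonormal]

/-- Torsion is tensorial, so it suffices to test it on the frame, where `Γ_ijk - Γ_jik = C_ijk` by
antisymmetry of `C` in its first two indices. -/
theorem IsHomogeneousFrame.connection_torsion_free (hF : IsHomogeneousFrame g F C)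
    {X Y : Π x : M, TangentSpace I x} {x : M} (hX : MDiffAt (T% X) x) (hY : MDiffAt (T% Y) x) :
    hF.connection Y x (X x) - hF.connection X x (Y x) = VectorField.mlieBracket I X Y x := by
  have : Nonempty M := ⟨x⟩
  have : IsManifold I 2 M := IsManifold.of_le (n := ∞) ENat.LEInfty.out
  have hT : ∀ u v : TangentSpace I x, hF.connection.torsion x u v = 0 := by
    have h0 : ∀ i j, hF.connection.torsion x (F i x) (F j x) = 0 := by
      intro i j
      rw [CovariantDerivative.torsion_apply _ ((hF.smooth i).mdifferentiable x)
        ((hF.smooth j).mdifferentiable x)]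
      refine hF.ext fun k => ?_
      simp only [map_sub, _root_.sub_apply, hF.coeff_connection_frame, hF.bracket, hF.coeff_sum,
        map_zero, _root_.zero_apply, frameChristoffel]
      rw [hF.antisymm j i k, hF.antisymm i k j, hF.antisymm k j i]
      ring
    intro u v
    rw [hF.expansion x u, hF.expansion x v]
    simp [map_sum, h0]
  have := hT (X x) (Y x)
  rw [CovariantDerivative.torsion_apply _ hX hY] at this
  exact sub_eq_zero.1 this

/-- Metric compatibility amounts to `Γ` being skew in its last two indices (`hanti`): the
Christoffel terms cancel and the product rule for coefficients remains. -/
theorem IsHomogeneousFrame.isLeviCivita_connection (hF : IsHomogeneousFrame g F C) :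
    IsLeviCivita g hF.connection where
  torsion_free X Y hX hY x :=
    hF.connection_torsion_free (hX.mdifferentiable x) (hY.mdifferentiable x)
  metric X Y Z hX hY hZ x := by
    have : Nonempty M := ⟨x⟩
    have h1 : (fun y => g.inner y (Y y) (Z y)) =
        fun y => ∑ k, frameCoeff g F Y k y * frameCoeff g F Z k y := by
      funext y
      exact hF.inner_eq y _ _
    have h2 : mvfderiv I (fun y => g.inner y (Y y) (Z y)) x (X x)
        = g.inner x (hF.connection Y x (X x)) (Z x)
          + g.inner x (Y x) (hF.connection Z x (X x)) := by
      rw [h1, mvfderiv_sum_mul_apply _ (hF.mdifferentiableAt_coeff (hY.mdifferentiable x))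
        (hF.mdifferentiableAt_coeff (hZ.mdifferentiable x)), hF.inner_eq x _ (Z x),
        hF.inner_eq x (Y x)]
      simp only [hF.coeff_connection, add_mul, mul_add, Finset.sum_add_distrib]
      have hanti : ∀ i j k, frameChristoffel C i k j = - frameChristoffel C i j k := by
        intro i j k
        simp only [frameChristoffel]
        rw [hF.antisymm i k j, hF.antisymm k j i, hF.antisymm j i k]
        ring
      have h3 : ∑ k, (∑ i, ∑ j, g.inner x (X x) (F i x) * frameCoeff g F Y j x *
            frameChristoffel C i j k) * g.inner x (Z x) (F k x)
          = - ∑ k, g.inner x (Y x) (F k x) * ∑ i, ∑ j, g.inner x (X x) (F i x) *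
            frameCoeff g F Z j x * frameChristoffel C i j k := by
        simp only [Finset.sum_mul, Finset.mul_sum, ← Finset.sum_neg_distrib]
        rw [Finset.sum_comm]
        conv_rhs => rw [Finset.sum_comm]
        refine Finset.sum_congr rfl fun i _ => ?_
        rw [Finset.sum_comm]
        refine Finset.sum_congr rfl fun j _ => Finset.sum_congr rfl fun k _ => ?_
        rw [hanti i k j]
        simp only [frameCoeff]
        ring
      rw [h3]
      simp only [frameCoeff]
      ring
    exact h2

theorem IsLeviCivita.koszul {nabla : CovariantDerivative I E (TangentSpace I : M → Type _)}
    (hn : IsLeviCivita g nabla) {X Y Z : Π x : M, TangentSpace I x}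
    (hX : IsSmoothVectorField X) (hY : IsSmoothVectorField Y) (hZ : IsSmoothVectorField Z) (x : M) :
    2 * g.inner x (nabla Y x (X x)) (Z x) =
      mvfderiv I (fun y => g.inner y (Y y) (Z y)) x (X x)
      + mvfderiv I (fun y => g.inner y (Z y) (X y)) x (Y x)
      - mvfderiv I (fun y => g.inner y (X y) (Y y)) x (Z x)
      + g.inner x (VectorField.mlieBracket I X Y x) (Z x)
      - g.inner x (VectorField.mlieBracket I Y Z x) (X x)
      + g.inner x (VectorField.mlieBracket I Z X x) (Y x) := by
  have m1 : mvfderiv I (fun y => g.inner y (Y y) (Z y)) x (X x) = _ := hn.metric X Y Z hX hY hZ x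
  have m2 : mvfderiv I (fun y => g.inner y (Z y) (X y)) x (Y x) = _ := hn.metric Y Z X hY hZ hX x
  have m3 : mvfderiv I (fun y => g.inner y (X y) (Y y)) x (Z x) = _ := hn.metric Z X Y hZ hX hY x
  rw [m1, m2, m3, ← hn.torsion_free X Y hX hY, ← hn.torsion_free Y Z hY hZ,
    ← hn.torsion_free Z X hZ hX]
  simp only [map_sub, _root_.sub_apply]
  rw [g.symm x (Y x) (nabla Z x (X x)), g.symm x (Z x) (nabla X x (Y x)),
    g.symm x (X x) (nabla Y x (Z x))]
  ring

/-- The Koszul formula has the same right-hand side for both connections. It constrains only smooth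
`Y`, since `IsLeviCivita` tests only smooth fields. -/
theorem IsHomogeneousFrame.eq_connection (hF : IsHomogeneousFrame g F C)
    {nabla : CovariantDerivative I E (TangentSpace I : M → Type _)} (hn : IsLeviCivita g nabla)
    {Y : Π x : M, TangentSpace I x} (hY : IsSmoothVectorField Y) (x : M) :
    nabla Y x = hF.connection Y x := by
  ext v
  rw [hF.expansion x v]
  simp only [map_sum, map_smul]
  refine Finset.sum_congr rfl fun i _ => ?_
  congr 1
  refine hF.ext fun k => ?_
  have h1 := hn.koszul (hF.smooth i) hY (hF.smooth k) x
  rw [← hF.isLeviCivita_connection.koszul (hF.smooth i) hY (hF.smooth k) x] at h1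
  linarith

end

end Frame

/-! ### Curvature of constant Christoffel symbols and its double trace. -/

section FrameAlgebra

variable {ι : Type*} [Fintype ι]

/-- The bilinear product on `ι → ℝ` with structure constants `Γ`. -/
noncomputable def structureProduct (Γ : ι → ι → ι → ℝ) : (ι → ℝ) →ₗ[ℝ] (ι → ℝ) →ₗ[ℝ] (ι → ℝ) :=
  LinearMap.mk₂ ℝ (fun u v k => ∑ i, ∑ j, u i * v j * Γ i j k)
    (by intros; funext k; simp [add_mul, Finset.sum_add_distrib])
    (by intros; funext k; simp [Finset.mul_sum, mul_assoc])
    (by intros; funext k; simp [add_mul, mul_add, Finset.sum_add_distrib])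
    (by intros; funext k; simp [Finset.mul_sum, mul_assoc, mul_left_comm])

theorem structureProduct_apply (Γ : ι → ι → ι → ℝ) (u v : ι → ℝ) (k : ι) :
    structureProduct Γ u v k = ∑ i, ∑ j, u i * v j * Γ i j k := rfl

/-- The curvature `R(u, v) w` of the constant-coefficient connection `Γ`. -/
noncomputable def structureCurvature (Γ : ι → ι → ι → ℝ) (u v w : ι → ℝ) : ι → ℝ :=
  structureProduct Γ u (structureProduct Γ v w) - structureProduct Γ v (structureProduct Γ u w)
    - structureProduct Γ (structureProduct Γ u v - structureProduct Γ v u) w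

variable [DecidableEq ι]

/-- Basis independence of the trace of a bilinear form, with orthogonality stated on the columns of
`O`, as the computation uses it. -/
theorem sum_bilin_orthogonal_rows {κ : Type*} [Fintype κ] (b : (ι → ℝ) →ₗ[ℝ] (ι → ℝ) →ₗ[ℝ] ℝ)
    (O : κ → ι → ℝ) (hO : ∀ a c, ∑ i, O i a * O i c = if a = c then 1 else 0) :
    ∑ i, b (O i) (O i) = ∑ a, b (Pi.single a 1) (Pi.single a 1) := by
  have h : ∀ u v : ι → ℝ, b u v = ∑ a, ∑ c, u a * v c * b (Pi.single a 1) (Pi.single c 1) := by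
    intro u v
    conv_lhs => rw [pi_eq_sum_univ' u, pi_eq_sum_univ' v]
    simp only [map_sum, map_smul, LinearMap.sum_apply,
      LinearMap.smul_apply, smul_eq_mul, Finset.mul_sum]
    rw [Finset.sum_comm]
    refine Finset.sum_congr rfl fun a _ => Finset.sum_congr rfl fun c _ => ?_
    ring
  simp only [fun i => h (O i) (O i)]
  rw [Finset.sum_comm]
  refine Finset.sum_congr rfl fun a _ => ?_
  rw [Finset.sum_comm]
  simp [← Finset.sum_mul, hO]

/-- Trace invariance is applied twice: to the first argument paired with the output, then to the two
remaining arguments. -/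
theorem sum_structureCurvature_orthogonal_rows {κ : Type*} [Fintype κ] (Γ : ι → ι → ι → ℝ)
    (O : κ → ι → ℝ) (hO : ∀ a c, ∑ i, O i a * O i c = if a = c then 1 else 0) :
    ∑ j, ∑ i, ∑ k, structureCurvature Γ (O i) (O j) (O j) k * O i k =
      ∑ b, ∑ a, structureCurvature Γ (Pi.single a 1) (Pi.single b 1) (Pi.single b 1) a := by
  have h1 : ∀ v w : ι → ℝ, ∑ i, ∑ k, structureCurvature Γ (O i) v w k * O i k =
      ∑ a, structureCurvature Γ (Pi.single a 1) v w a := by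
    intro v w
    let b : (ι → ℝ) →ₗ[ℝ] (ι → ℝ) →ₗ[ℝ] ℝ :=
      LinearMap.mk₂ ℝ (fun u z => ∑ k, structureCurvature Γ u v w k * z k)
        (by
          intro u u' z
          rw [← Finset.sum_add_distrib]
          refine Finset.sum_congr rfl fun k _ => ?_
          simp [structureCurvature]
          ring)
        (by
          intro c u z
          rw [smul_eq_mul, Finset.mul_sum]
          refine Finset.sum_congr rfl fun k _ => ?_
          simp [structureCurvature]
          ring)
        (by intro u z z'; simp [mul_add, Finset.sum_add_distrib])
        (by intro c u z; simp [Finset.mul_sum, mul_left_comm])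
    have := sum_bilin_orthogonal_rows b O hO
    simpa [b, Pi.single_apply] using this
  simp only [h1]
  rw [Finset.sum_comm]
  conv_rhs => rw [Finset.sum_comm]
  refine Finset.sum_congr rfl fun a _ => ?_
  let b : (ι → ℝ) →ₗ[ℝ] (ι → ℝ) →ₗ[ℝ] ℝ :=
    LinearMap.mk₂ ℝ (fun v w => structureCurvature Γ (Pi.single a 1) v w a)
      (by intros; simp [structureCurvature]; ring)
      (by intros; simp [structureCurvature]; ring)
      (by intros; simp [structureCurvature]; ring)
      (by intros; simp [structureCurvature]; ring)
  exact sum_bilin_orthogonal_rows b O hO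

theorem sum_sum_sum_cycle (f : ι → ι → ι → ℝ) :
    ∑ a, ∑ b, ∑ m, f b m a = ∑ a, ∑ b, ∑ m, f a b m := by
  rw [Finset.sum_comm]
  refine Finset.sum_congr rfl fun b _ => ?_
  rw [Finset.sum_comm]

theorem sum_structureCurvature_frameChristoffel {C : ι → ι → ι → ℝ}
    (hC : ∀ i j k, C i j k = -C j i k) (hU : ∀ j, ∑ i, C j i i = 0) :
    ∑ b, ∑ a, structureCurvature (frameChristoffel C)
        (Pi.single a 1) (Pi.single b 1) (Pi.single b 1) a =
      -(1 / 4) * ∑ i, ∑ j, ∑ k, C i j k ^ 2 - 1 / 2 * ∑ i, ∑ j, ∑ k, C i j k * C i k j := by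
  have hs : ∀ (i j : ι), structureProduct (frameChristoffel C) (Pi.single i 1) (Pi.single j 1) =
      frameChristoffel C i j := by
    intro i j
    funext k
    simp [structureProduct_apply, Pi.single_apply]
  have hl : ∀ (i k : ι) (v : ι → ℝ), structureProduct (frameChristoffel C) (Pi.single i 1) v k =
      ∑ m, v m * frameChristoffel C i m k := by
    intro i k v
    simp [structureProduct_apply, Pi.single_apply]
  have hr : ∀ (i k : ι) (v : ι → ℝ), structureProduct (frameChristoffel C) v (Pi.single i 1) k =
      ∑ m, v m * frameChristoffel C m i k := by
    intro i k v
    simp [structureProduct_apply, Pi.single_apply]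
  -- The first sum dies by unimodularity. The second is arranged so that, after summation, each
  -- difference of squares vanishes by cyclic relabelling and the three mixed products have equal
  -- sums.
  have hterm : ∀ a b, structureCurvature (frameChristoffel C)
        (Pi.single a 1) (Pi.single b 1) (Pi.single b 1) a =
      ∑ m, (frameChristoffel C b b m * -C m a a) +
        ∑ m, (-(1 / 4) * C a b m ^ 2 - 1 / 4 * (C a b m ^ 2 - C b m a ^ 2)
          - 1 / 4 * (C a b m ^ 2 - C m a b ^ 2) - 1 / 2 * (C b m a * C m a b)
          + 1 / 2 * (C a b m * C b m a) + 1 / 2 * (C m a b * C a b m)) := by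
    intro a b
    simp only [structureCurvature, hs, Pi.sub_apply, hl, hr]
    rw [← Finset.sum_sub_distrib, ← Finset.sum_sub_distrib, ← Finset.sum_add_distrib]
    refine Finset.sum_congr rfl fun m _ => ?_
    have h0 : C a a m = 0 := by linarith [hC a a m]
    have h1 : C b b m = 0 := by linarith [hC b b m]
    simp only [frameChristoffel, h0, h1]
    rw [hC a m a, hC b a m, hC m b a, hC a m b]
    ring
  simp only [hterm, Finset.sum_add_distrib, Finset.sum_sub_distrib, ← Finset.mul_sum]
  have t1 : ∑ b, ∑ a, ∑ m, (frameChristoffel C b b m * -C m a a) = 0 := by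
    refine Finset.sum_eq_zero fun b _ => ?_
    rw [Finset.sum_comm]
    refine Finset.sum_eq_zero fun m _ => ?_
    rw [← Finset.mul_sum, Finset.sum_neg_distrib, hU, neg_zero, mul_zero]
  have sw : ∀ f : ι → ι → ι → ℝ, ∑ b, ∑ a, ∑ m, f a b m = ∑ a, ∑ b, ∑ m, f a b m :=
    fun f => Finset.sum_comm
  rw [t1, sw (fun a b m => C a b m ^ 2), sw (fun a b m => C b m a ^ 2),
    sw (fun a b m => C m a b ^ 2), sw (fun a b m => C b m a * C m a b),
    sw (fun a b m => C a b m * C b m a), sw (fun a b m => C m a b * C a b m),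
    sum_sum_sum_cycle (fun a b m => C a b m ^ 2),
    ← sum_sum_sum_cycle (fun a b m => C m a b ^ 2),
    sum_sum_sum_cycle (fun a b m => C a b m * C b m a),
    ← sum_sum_sum_cycle (fun a b m => C m a b * C a b m)]
  have t2 : ∑ i, ∑ j, ∑ k, C i j k * C i k j = - ∑ a, ∑ b, ∑ m, C a b m * C b m a := by
    simp only [← Finset.sum_neg_distrib]
    rw [← sum_sum_sum_cycle (fun i j k => C i j k * C i k j)]
    refine Finset.sum_congr rfl fun i _ => Finset.sum_congr rfl fun j _ =>
      Finset.sum_congr rfl fun k _ => ?_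
    rw [hC j i k]
    ring
  rw [t2]
  ring

end FrameAlgebra

/-! ### Curvature of arbitrary smooth fields in a homogeneous frame. -/

section FrameCurvature

variable {E : Type*} [NormedAddCommGroup E] [NormedSpace ℝ E] [FiniteDimensional ℝ E]
  {H : Type*} [TopologicalSpace H] {I : ModelWithCorners ℝ E H}
  {M : Type*} [TopologicalSpace M] [ChartedSpace H M] [IsManifold I ∞ M]
  {ι : Type*} [Fintype ι] [DecidableEq ι]
  {g : Bundle.ContMDiffRiemannianMetric I ∞ E (TangentSpace I : M → Type _)}
  {F : ι → Π x : M, TangentSpace I x} {C : ι → ι → ι → ℝ}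

/-- Since `[Y, f F_k] = (Y f) F_k + f [Y, F_k]`, the function `Y f` is a difference of smooth frame
coefficients. -/
theorem IsHomogeneousFrame.contMDiff_mvfderiv (hF : IsHomogeneousFrame g F C) (k : ι) {f : M → ℝ}
    {Y : Π x : M, TangentSpace I x} (hf : ContMDiff I 𝓘(ℝ, ℝ) ∞ f) (hY : IsSmoothVectorField Y) :
    ContMDiff I 𝓘(ℝ, ℝ) ∞ (fun y => mvfderiv I f y (Y y)) := by
  have h : (fun y => mvfderiv I f y (Y y)) =
      fun y => frameCoeff g F (VectorField.mlieBracket I Y (f • F k)) k y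
        - f y * frameCoeff g F (VectorField.mlieBracket I Y (F k)) k y := by
    funext y
    rw [mlieBracket_smul_right_eq (hF.smooth k) hf]
    simp [frameCoeff, hF.orthonormal]
  rw [h]
  exact (hF.contMDiff_coeff (hY.mlieBracket ((hF.smooth k).smul hf)) k).sub
    (hf.mul (hF.contMDiff_coeff (hY.mlieBracket (hF.smooth k)) k))

theorem IsHomogeneousFrame.coeff_mlieBracket (hF : IsHomogeneousFrame g F C)
    {X Y : Π x : M, TangentSpace I x} (hX : IsSmoothVectorField X) (hY : IsSmoothVectorField Y)
    (x : M) (k : ι) :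
    g.inner x (VectorField.mlieBracket I X Y x) (F k x) =
      mvfderiv I (frameCoeff g F Y k) x (X x)
        + structureProduct (frameChristoffel C) (fun i => frameCoeff g F X i x)
            (fun i => frameCoeff g F Y i x) k
      - (mvfderiv I (frameCoeff g F X k) x (Y x)
        + structureProduct (frameChristoffel C) (fun i => frameCoeff g F Y i x)
            (fun i => frameCoeff g F X i x) k) := by
  rw [← hF.connection_torsion_free (hX.mdifferentiable x) (hY.mdifferentiable x), map_sub,
    _root_.sub_apply, hF.coeff_connection, hF.coeff_connection]
  rfl

theorem IsHomogeneousFrame.coeff_second_derivative (hF : IsHomogeneousFrame g F C)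
    {X Y Z : Π x : M, TangentSpace I x} (hY : IsSmoothVectorField Y)
    (hZ : IsSmoothVectorField Z) (x : M) (k : ι) :
    g.inner x (hF.connection (fun y => hF.connection Z y (Y y)) x (X x)) (F k x) =
      mvfderiv I (fun y => mvfderiv I (frameCoeff g F Z k) y (Y y)) x (X x)
      + structureProduct (frameChristoffel C)
          (fun i => mvfderiv I (frameCoeff g F Y i) x (X x)) (fun i => frameCoeff g F Z i x) k
      + structureProduct (frameChristoffel C) (fun i => frameCoeff g F Y i x)
          (fun i => mvfderiv I (frameCoeff g F Z i) x (X x)) k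
      + structureProduct (frameChristoffel C) (fun i => frameCoeff g F X i x)
          ((fun i => mvfderiv I (frameCoeff g F Z i) x (Y x))
            + structureProduct (frameChristoffel C) (fun i => frameCoeff g F Y i x)
                (fun i => frameCoeff g F Z i x)) k := by
  have hZd := fun i => (hF.contMDiff_coeff hZ i).mdifferentiable (by simp) x
  have hYd := fun i => (hF.contMDiff_coeff hY i).mdifferentiable (by simp) x
  have hc : ∀ c : ℝ, MDifferentiableAt I 𝓘(ℝ, ℝ) (fun _ : M => c) x :=
    fun c => mdifferentiableAt_const
  have h : frameCoeff g F (fun y => hF.connection Z y (Y y)) k =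
      fun y => mvfderiv I (frameCoeff g F Z k) y (Y y) +
        ∑ i, frameCoeff g F Y i y * ∑ j, frameCoeff g F Z j y * frameChristoffel C i j k := by
    funext y
    simp only [frameCoeff, hF.coeff_connection, Finset.mul_sum, mul_assoc]
  have hin : ∀ i, MDifferentiableAt I 𝓘(ℝ, ℝ)
      (fun y => ∑ j, frameCoeff g F Z j y * frameChristoffel C i j k) x := fun i =>
    (mdifferentiableAt_sum_mvfderiv_sum _
      (f := fun j y => frameCoeff g F Z j y * frameChristoffel C i j k)
      fun j => (hZd j).mul (hc _)).1
  rw [hF.coeff_connection, h, mvfderiv_fun_add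
    ((hF.contMDiff_mvfderiv k (hF.contMDiff_coeff hZ k) hY).mdifferentiable (by simp) x)
    (mdifferentiableAt_sum_mvfderiv_sum _
      (f := fun i y => frameCoeff g F Y i y *
        ∑ j, frameCoeff g F Z j y * frameChristoffel C i j k)
      fun i => (hYd i).mul (hin i)).1, _root_.add_apply,
    mvfderiv_sum_mul_apply _ hYd hin]
  simp only [mvfderiv_sum_mul_apply _ hZd (fun _ => hc _), mvfderiv_const, _root_.zero_apply,
    mul_zero, add_zero, Finset.sum_add_distrib, structureProduct_apply, Finset.mul_sum, mul_assoc,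
    Pi.add_apply]
  rw [add_assoc, add_assoc, add_assoc, add_assoc]
  congr 3
  simp only [frameCoeff, hF.coeff_connection, mul_assoc]

/-- Tensoriality of curvature: second derivatives of `Z` cancel because `[X, Y] f = X (Y f) - Y (X
f)`, and all first derivatives cancel too, so only the coefficients at `x` survive. -/
theorem IsHomogeneousFrame.coeff_curvatureAt (hF : IsHomogeneousFrame g F C)
    {X Y Z : Π x : M, TangentSpace I x} (hX : IsSmoothVectorField X) (hY : IsSmoothVectorField Y)
    (hZ : IsSmoothVectorField Z) (x : M) (k : ι) :
    g.inner x (curvatureAt hF.connection X Y Z x) (F k x) =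
      structureCurvature (frameChristoffel C) (fun i => frameCoeff g F X i x)
        (fun i => frameCoeff g F Y i x) (fun i => frameCoeff g F Z i x) k := by
  have hFk : F k x ≠ 0 := by
    intro h0
    have := hF.orthonormal x k k
    simp [h0] at this
  have hZk := hF.contMDiff_coeff hZ k
  have hbr : (fun i => g.inner x (VectorField.mlieBracket I X Y x) (F i x)) =
      (fun i => mvfderiv I (frameCoeff g F Y i) x (X x))
        + structureProduct (frameChristoffel C) (fun i => frameCoeff g F X i x)
            (fun i => frameCoeff g F Y i x)
      - ((fun i => mvfderiv I (frameCoeff g F X i) x (Y x))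
        + structureProduct (frameChristoffel C) (fun i => frameCoeff g F Y i x)
            (fun i => frameCoeff g F X i x)) := by
    funext i
    exact hF.coeff_mlieBracket hX hY x i
  have h3 : g.inner x (hF.connection Z x (VectorField.mlieBracket I X Y x)) (F k x) =
      mvfderiv I (frameCoeff g F Z k) x (VectorField.mlieBracket I X Y x) +
        structureProduct (frameChristoffel C)
          (fun i => g.inner x (VectorField.mlieBracket I X Y x) (F i x))
          (fun i => frameCoeff g F Z i x) k := hF.coeff_connection _ _ _ _
  simp only [curvatureAt, map_sub, _root_.sub_apply]
  rw [hF.coeff_second_derivative hY hZ, hF.coeff_second_derivative hX hZ, h3, hbr,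
    mvfderiv_mlieBracket hX hY (hF.smooth k) hFk hZk (hF.contMDiff_mvfderiv k hZk hX)
      (hF.contMDiff_mvfderiv k hZk hY)]
  simp only [structureCurvature, map_add, map_sub, LinearMap.add_apply, LinearMap.sub_apply,
    Pi.add_apply, Pi.sub_apply]
  ring

/-- Lets `IsHomogeneousFrame.eq_connection` be applied a second time, to the inner covariant
derivatives in the curvature. -/
theorem IsHomogeneousFrame.isSmoothVectorField_connection (hF : IsHomogeneousFrame g F C)
    {Y Z : Π x : M, TangentSpace I x} (hY : IsSmoothVectorField Y) (hZ : IsSmoothVectorField Z) :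
    IsSmoothVectorField (fun y => hF.connection Z y (Y y)) := by
  have h : (fun y => hF.connection Z y (Y y)) =
      fun y => ∑ k, ((fun y => mvfderiv I (frameCoeff g F Z k) y (Y y) +
        ∑ i, ∑ j, frameCoeff g F Y i y * frameCoeff g F Z j y * frameChristoffel C i j k)
          • F k) y := by
    funext y
    rw [hF.expansion y (hF.connection Z y (Y y))]
    simp only [hF.coeff_connection]
    rfl
  rw [h]
  refine IsSmoothVectorField.sum fun k => (hF.smooth k).smul ?_
  refine (hF.contMDiff_mvfderiv k (hF.contMDiff_coeff hZ k) hY).add ?_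
  refine contMDiff_finsetSum fun i _ => contMDiff_finsetSum fun j _ => ?_
  exact ((hF.contMDiff_coeff hY i).mul (hF.contMDiff_coeff hZ j)).mul contMDiff_const

theorem IsHomogeneousFrame.curvatureAt_eq (hF : IsHomogeneousFrame g F C)
    {nabla : CovariantDerivative I E (TangentSpace I : M → Type _)} (hn : IsLeviCivita g nabla)
    {X Y Z : Π x : M, TangentSpace I x} (hX : IsSmoothVectorField X) (hY : IsSmoothVectorField Y)
    (hZ : IsSmoothVectorField Z) (x : M) :
    curvatureAt nabla X Y Z x = curvatureAt hF.connection X Y Z x := by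
  simp only [curvatureAt, hF.eq_connection hn hZ]
  rw [hF.eq_connection hn (hF.isSmoothVectorField_connection hY hZ),
    hF.eq_connection hn (hF.isSmoothVectorField_connection hX hZ)]

/-- Scalar curvature of a metric with a homogeneous orthonormal frame of unimodular type. -/
theorem IsHomogeneousFrame.hasScalarCurvatureAt (hF : IsHomogeneousFrame g F C)
    (hcard : Fintype.card ι = Module.finrank ℝ E) (hU : ∀ j, ∑ i, C j i i = 0) (x : M) :
    HasScalarCurvatureAt g x
      (-(1 / 4) * ∑ i, ∑ j, ∑ k, C i j k ^ 2 - 1 / 2 * ∑ i, ∑ j, ∑ k, C i j k * C i k j) := by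
  have : Nonempty M := ⟨x⟩
  refine ⟨⟨hF.connection, hF.isLeviCivita_connection⟩, fun nabla hn e he ho => ?_⟩
  have hO : ∀ a c, ∑ i, frameCoeff g F (e i) a x * frameCoeff g F (e i) c x =
      if a = c then 1 else 0 := by
    -- Orthonormality of the `e i` gives `A * Aᵀ = 1`; the column relations need `Aᵀ * A = 1`, which
    -- follows once `A` is made square by reindexing.
    let σ := Fintype.equivFinOfCardEq hcard
    let A : Matrix (Fin (Module.finrank ℝ E)) (Fin (Module.finrank ℝ E)) ℝ :=
      Matrix.of fun i a => frameCoeff g F (e i) (σ.symm a) x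
    have h1 : A * A.transpose = 1 := by
      ext i j
      rw [Matrix.mul_apply, Matrix.one_apply, ← ho i j, hF.inner_eq]
      exact (Equiv.sum_comp σ.symm fun a => frameCoeff g F (e i) a x * frameCoeff g F (e j) a x)
    have h2 : A.transpose * A = 1 := mul_eq_one_comm.1 h1
    intro a c
    have := congrFun (congrFun h2 (σ a)) (σ c)
    rw [Matrix.mul_apply, Matrix.one_apply] at this
    simpa only [A, Matrix.transpose_apply, Matrix.of_apply, Equiv.symm_apply_apply,
      EmbeddingLike.apply_eq_iff_eq] using this
  rw [← sum_structureCurvature_frameChristoffel hF.antisymm hU,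
    ← sum_structureCurvature_orthogonal_rows _ _ hO]
  refine Finset.sum_congr rfl fun j _ => Finset.sum_congr rfl fun i _ => ?_
  rw [hF.curvatureAt_eq hn (he i) (he j) (he j), hF.inner_eq]
  simp only [hF.coeff_curvatureAt (he i) (he j) (he j)]
  rfl

end FrameCurvature

theorem eq_sum_of_bilin_orthonormal {V ι : Type*} [AddCommGroup V] [Module ℝ V]
    [FiniteDimensional ℝ V] [Fintype ι] [DecidableEq ι] (b : V →ₗ[ℝ] V →ₗ[ℝ] ℝ) {f : ι → V}
    (ho : ∀ i j, b (f i) (f j) = if i = j then 1 else 0)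
    (hcard : Fintype.card ι = Module.finrank ℝ V) (v : V) : v = ∑ i, b v (f i) • f i := by
  have hc : ∀ (a : ι → ℝ) j, b (∑ i, a i • f i) (f j) = a j := by
    intro a j
    rw [map_sum, LinearMap.sum_apply]
    simp [ho]
  have hli : LinearIndependent ℝ f := by
    rw [Fintype.linearIndependent_iff]
    intro a ha j
    rw [← hc a j, ha, map_zero, LinearMap.zero_apply]
  let B := basisOfLinearIndependentOfCardEqFinrank' f hli hcard
  have h : v = ∑ i, B.repr v i • f i := by
    conv_lhs => rw [← B.sum_repr v]
    simp [B]
  conv_lhs => rw [h]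
  refine Finset.sum_congr rfl fun j _ => ?_
  rw [← hc (fun i => B.repr v i) j, ← h]

/-! ### Left-invariant frames on a Lie group. -/

section Group

variable {E : Type*} [NormedAddCommGroup E] [NormedSpace ℝ E] [FiniteDimensional ℝ E]
  {H : Type*} [TopologicalSpace H] {I : ModelWithCorners ℝ E H}
  {G : Type*} [TopologicalSpace G] [ChartedSpace H G] [Group G] [LieGroup I ∞ G]
  {ι : Type*} [Fintype ι] [DecidableEq ι]

/-- The field is the tangent map of multiplication applied to the smooth family `(0, v)` at `(g,
1)`. -/
theorem isSmoothVectorField_mulInvariantVectorField (v : GroupLieAlgebra I G) :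
    IsSmoothVectorField (mulInvariantVectorField v : Π x : G, TangentSpace I x) := by
  let fg : G → TangentBundle I G := fun g => Bundle.TotalSpace.mk' E g 0
  have sfg : ContMDiff I I.tangent ∞ fg := Bundle.contMDiff_zeroSection _ _
  let fv : G → TangentBundle I G := fun _ => Bundle.TotalSpace.mk' E 1 v
  have sfv : ContMDiff I I.tangent ∞ fv := contMDiff_const
  have S₁ : ContMDiff I (I.tangent.prod I.tangent) ∞ (fun g => (fg g, fv g)) := sfg.prodMk sfv
  have S₂ : ContMDiff (I.tangent.prod I.tangent) (I.prod I).tangent ∞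
      (equivTangentBundleProd I G I G).symm := contMDiff_equivTangentBundleProd_symm
  have S₃ : ContMDiff (I.prod I).tangent I.tangent ∞
      (tangentMap (I.prod I) I (fun p : G × G => p.1 * p.2)) :=
    (contMDiff_mul I ∞).contMDiff_tangentMap (m := ∞) le_rfl
  have S := (S₃.comp S₂).comp S₁
  unfold IsSmoothVectorField
  convert! S with g
  · simp [fg, fv]
  · have h := mfderiv_prod_eq_add_apply (I := I) (I' := I) (I'' := I)
      (f := fun p : G × G => p.1 * p.2) (p := (g, 1)) (v := ((0, v) : E × E))
      ((contMDiff_mul I ∞).mdifferentiable (by simp) _)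
    exact (h.trans ((congrArg (· + _) (map_zero (mfderiv I I (fun y => y * (1 : G)) g))).trans
      (zero_add _))).symm

theorem metric_mulInvariantVectorField
    {g : Bundle.ContMDiffRiemannianMetric I ∞ E (TangentSpace I : G → Type _)}
    (hg : IsLeftInvariantMetric g) (x : G) (u v : GroupLieAlgebra I G) :
    g.inner x (mulInvariantVectorField u x) (mulInvariantVectorField v x) =
      g.inner 1 u v := by
  -- Left invariance lands at `x * 1`, which is only propositionally `x`; viewing every tangent
  -- space as `E` makes the transport trivial.
  have key : ∀ (y : G), x * 1 = y → ∀ a b : E, (g.inner (x * 1) : E →L[ℝ] E →L[ℝ] ℝ) a b =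
      (g.inner y : E →L[ℝ] E →L[ℝ] ℝ) a b := by
    rintro y rfl a b
    rfl
  rw [← hg x 1 u v]
  exact (key x (mul_one x) _ _).symm

/-- The coefficients are constant because brackets of left-invariant fields are left-invariant. -/
theorem isHomogeneousFrame_mulInvariantVectorField
    {g : Bundle.ContMDiffRiemannianMetric I ∞ E (TangentSpace I : G → Type _)}
    (hg : IsLeftInvariantMetric g) {e : ι → GroupLieAlgebra I G}
    (he : ∀ i j, g.inner 1 (e i) (e j) = if i = j then 1 else 0)
    (hcard : Fintype.card ι = Module.finrank ℝ E) :
    IsHomogeneousFrame g (fun i x => mulInvariantVectorField (e i) x)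
      (fun i j k => g.inner 1 ⁅e i, e j⁆ (e k)) where
  smooth i := isSmoothVectorField_mulInvariantVectorField (e i)
  orthonormal x i j := by rw [metric_mulInvariantVectorField hg, he]
  expansion x v := by
    have : FiniteDimensional ℝ (TangentSpace I x) := inferInstanceAs (FiniteDimensional ℝ E)
    let b : TangentSpace I x →ₗ[ℝ] TangentSpace I x →ₗ[ℝ] ℝ :=
      LinearMap.mk₂ ℝ (fun u w => g.inner x u w) (by intros; simp) (by intros; simp)
        (by intros; simp) (by intros; simp)
    exact eq_sum_of_bilin_orthonormal b
      (fun i j => by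
        change g.inner x (mulInvariantVectorField (e i) x) (mulInvariantVectorField (e j) x) = _
        rw [metric_mulInvariantVectorField hg, he]) hcard v
  bracket x i j := by
    have : FiniteDimensional ℝ (GroupLieAlgebra I G) := inferInstanceAs (FiniteDimensional ℝ E)
    let b : GroupLieAlgebra I G →ₗ[ℝ] GroupLieAlgebra I G →ₗ[ℝ] ℝ :=
      LinearMap.mk₂ ℝ (fun u w => g.inner 1 u w) (by intros; simp) (by intros; simp)
        (by intros; simp) (by intros; simp)
    have h1 : ⁅e i, e j⁆ = ∑ k, g.inner 1 ⁅e i, e j⁆ (e k) • e k :=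
      eq_sum_of_bilin_orthonormal b he hcard _
    have h2 : VectorField.mlieBracket I (mulInvariantVectorField (e i))
        (mulInvariantVectorField (e j)) = mulInvariantVectorField ⁅e i, e j⁆ :=
      (mulInvariantVector_mlieBracket (e i) (e j)).symm
    change VectorField.mlieBracket I (mulInvariantVectorField (e i))
        (mulInvariantVectorField (e j)) x = _
    rw [h2]
    conv_lhs => rw [h1]
    exact (map_sum (mfderiv I I (x * ·) (1 : G)) _ _).trans
      (Finset.sum_congr rfl fun k _ => map_smul (mfderiv I I (x * ·) (1 : G)) _ _)

end Group

/-! ### Orthonormal bases with signs. -/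

section SignedBasis

variable {V ι : Type*} [AddCommGroup V] [Module ℝ V] [Fintype ι] [DecidableEq ι]

/-- A spanning family orthogonal for a bilinear form, with squares `ε i = ±1`. -/
structure IsSignedBasis (b : V →ₗ[ℝ] V →ₗ[ℝ] ℝ) (z : ι → V) (ε : ι → ℝ) : Prop where
  orthogonal : ∀ i j, b (z i) (z j) = if i = j then ε i else 0
  sq : ∀ i, ε i * ε i = 1
  expansion : ∀ v, v = ∑ i, (ε i * b v (z i)) • z i

variable {b : V →ₗ[ℝ] V →ₗ[ℝ] ℝ} {z : ι → V} {ε : ι → ℝ}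

theorem IsSignedBasis.apply_sum (h : IsSignedBasis b z ε) (a : ι → ℝ) (j : ι) :
    ε j * b (∑ i, a i • z i) (z j) = a j := by
  rw [map_sum, LinearMap.sum_apply]
  simp only [map_smul, LinearMap.smul_apply, h.orthogonal, smul_eq_mul, mul_ite, mul_zero,
    Finset.sum_ite_eq', Finset.mem_univ, if_true]
  rw [mul_left_comm, h.sq, mul_one]

/-- The basis underlying a signed basis. -/
noncomputable def IsSignedBasis.toBasis (h : IsSignedBasis b z ε) : Module.Basis ι ℝ V :=
  Module.Basis.mk
    (by
      rw [Fintype.linearIndependent_iff]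
      intro a ha j
      rw [← h.apply_sum a j, ha, map_zero, LinearMap.zero_apply, mul_zero])
    (fun v _ => by
      rw [h.expansion v]
      exact Submodule.sum_mem _ fun i _ => Submodule.smul_mem _ _ (Submodule.subset_span ⟨i, rfl⟩))

theorem IsSignedBasis.toBasis_apply (h : IsSignedBasis b z ε) (i : ι) : h.toBasis i = z i := by
  simp [IsSignedBasis.toBasis]

theorem IsSignedBasis.repr_apply (h : IsSignedBasis b z ε) (v : V) (i : ι) :
    h.toBasis.repr v i = ε i * b v (z i) := by
  conv_rhs => rw [← h.toBasis.sum_repr v]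
  simp only [h.toBasis_apply]
  rw [h.apply_sum]

theorem IsSignedBasis.card_eq (h : IsSignedBasis b z ε) :
    Fintype.card ι = Module.finrank ℝ V :=
  (Module.finrank_eq_card_basis h.toBasis).symm

theorem IsSignedBasis.trace_eq (h : IsSignedBasis b z ε) (T : V →ₗ[ℝ] V) :
    LinearMap.trace ℝ V T = ∑ i, ε i * b (T (z i)) (z i) := by
  rw [LinearMap.trace_eq_matrix_trace ℝ h.toBasis, Matrix.trace]
  refine Finset.sum_congr rfl fun i _ => ?_
  rw [Matrix.diag_apply, LinearMap.toMatrix_apply, h.repr_apply, h.toBasis_apply]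

theorem IsSignedBasis.bilin_eq (h : IsSignedBasis b z ε) (v w : V) :
    b v w = ∑ i, ε i * (b v (z i) * b w (z i)) := by
  conv_lhs => rw [h.expansion w]
  rw [map_sum]
  refine Finset.sum_congr rfl fun i _ => ?_
  rw [map_smul, smul_eq_mul]
  ring

/-- The sign `σ` treats at once the positive definite form on `p` and the negative definite ones on
the `k_i`. -/
theorem exists_isSignedBasis_of_definite [FiniteDimensional ℝ V] (b : V →ₗ[ℝ] V →ₗ[ℝ] ℝ)
    (hb : ∀ v w, b v w = b w v) (σ : ℝ) (hσ : σ * σ = 1) (hpos : ∀ v, v ≠ 0 → 0 < σ * b v v) :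
    ∃ z : Fin (Module.finrank ℝ V) → V, IsSignedBasis b z (fun _ => σ) := by
  obtain ⟨v, hv⟩ := LinearMap.BilinForm.exists_orthogonal_basis (B := b) ⟨fun x y => hb x y⟩
  have hp : ∀ i, 0 < σ * b (v i) (v i) := fun i => hpos _ (v.ne_zero i)
  have hs : ∀ i, Real.sqrt (σ * b (v i) (v i)) ≠ 0 := fun i => (Real.sqrt_pos.2 (hp i)).ne'
  let u := v.isUnitSMul (w := fun i => (Real.sqrt (σ * b (v i) (v i)))⁻¹)
    (fun i => (inv_ne_zero (hs i)).isUnit)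
  have hu : ∀ i, u i = (Real.sqrt (σ * b (v i) (v i)))⁻¹ • v i := fun i =>
    Module.Basis.isUnitSMul_apply _ _
  have horth : ∀ i j, b (u i) (u j) = if i = j then σ else 0 := by
    intro i j
    rw [hu, hu]
    simp only [map_smul, LinearMap.smul_apply, smul_eq_mul]
    split_ifs with hij
    · subst hij
      have h1 := Real.mul_self_sqrt (hp i).le
      have h2 : b (v i) (v i) = σ * (Real.sqrt (σ * b (v i) (v i)) *
          Real.sqrt (σ * b (v i) (v i))) := by
        rw [h1, ← mul_assoc, hσ, one_mul]
      have := hs i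
      generalize Real.sqrt (σ * b (v i) (v i)) = t at *
      rw [h2]
      field_simp
    · rw [(LinearMap.isOrthoᵢ_def.1 hv) i j hij, mul_zero, mul_zero]
  refine ⟨u, horth, fun _ => hσ, fun x => ?_⟩
  conv_lhs => rw [← u.sum_repr x]
  refine Finset.sum_congr rfl fun j _ => ?_
  congr 1
  conv_rhs => rw [← u.sum_repr x]
  rw [map_sum, LinearMap.sum_apply]
  simp only [map_smul, LinearMap.smul_apply, horth, smul_eq_mul, mul_ite, mul_zero,
    Finset.sum_ite_eq', Finset.mem_univ, if_true]
  rw [mul_left_comm, hσ, mul_one]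

end SignedBasis

/-! ### Simple ideals: commutation and orthogonality. -/

section LieSimple

variable {L : Type*} [LieRing L] [LieAlgebra ℝ L]

theorem killingForm_symm {L : Type*} [LieRing L] [LieAlgebra ℝ L] (X Y : L) :
    killingForm ℝ L X Y = killingForm ℝ L Y X :=
  LieModule.traceForm_comm ℝ L L X Y

theorem killingForm_lie {L : Type*} [LieRing L] [LieAlgebra ℝ L] (X Y Z : L) :
    killingForm ℝ L ⁅X, Y⁆ Z = killingForm ℝ L X ⁅Y, Z⁆ :=
  LieModule.traceForm_apply_lie_apply ℝ L L X Y Z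

theorem isSimple_of_lieEquiv {L₁ L₂ : Type*} [LieRing L₁] [LieAlgebra ℝ L₁] [LieRing L₂]
    [LieAlgebra ℝ L₂] (e : L₁ ≃ₗ⁅ℝ⁆ L₂) (h : LieAlgebra.IsSimple ℝ L₁) :
    LieAlgebra.IsSimple ℝ L₂ where
  eq_bot_or_eq_top I := by
    rcases h.eq_bot_or_eq_top (I.comap e.toLieHom) with hI | hI
    · left
      rw [eq_bot_iff]
      intro x hx
      have h1 : e.symm x ∈ I.comap e.toLieHom := by
        rw [LieIdeal.mem_comap]
        simpa using hx
      rw [hI, LieSubmodule.mem_bot] at h1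
      rw [LieSubmodule.mem_bot, ← e.apply_symm_apply x, h1, map_zero]
    · right
      rw [eq_top_iff]
      intro x _
      have h1 : e.symm x ∈ I.comap e.toLieHom := hI ▸ LieSubmodule.mem_top _
      rw [LieIdeal.mem_comap] at h1
      simpa using h1
  non_abelian := by
    rw [← lie_abelian_iff_equiv_lie_abelian e]
    exact h.non_abelian

/-- A subspace stable under a simple subalgebra and meeting it non-trivially contains it. -/
theorem le_of_isSimple_of_stable {h : LieSubalgebra ℝ L} (hs : LieAlgebra.IsSimple ℝ h)
    (W : Submodule ℝ L) (hW : ∀ X ∈ h, ∀ Y ∈ h, Y ∈ W → ⁅X, Y⁆ ∈ W)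
    (hne : ∃ X ∈ h, X ∈ W ∧ X ≠ 0) : h.toSubmodule ≤ W := by
  let J : LieIdeal ℝ h :=
    { W.comap h.toSubmodule.subtype with
      lie_mem := fun {x y} hy => hW x x.2 y y.2 hy }
  have hJ : ∀ x : h, x ∈ J ↔ (x : L) ∈ W := fun x => Iff.rfl
  rcases hs.eq_bot_or_eq_top J with h0 | h1
  · obtain ⟨X, hX, hXW, hX0⟩ := hne
    have : (⟨X, hX⟩ : h) ∈ J := hXW
    rw [h0, LieSubmodule.mem_bot] at this
    exact absurd (congrArg Subtype.val this) hX0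
  · intro X hX
    have : (⟨X, hX⟩ : h) ∈ J := h1 ▸ LieSubmodule.mem_top _
    exact this

theorem exists_lie_ne_zero_of_isSimple {h : LieSubalgebra ℝ L} (hs : LieAlgebra.IsSimple ℝ h) :
    ∃ X ∈ h, ∃ Y ∈ h, ⁅X, Y⁆ ≠ 0 := by
  by_contra! hc
  exact hs.non_abelian ⟨fun X Y => Subtype.ext (hc X X.2 Y Y.2)⟩

/-- The bracket lies in both ideals; if it were non-zero, simplicity would make each contain the
other. -/
theorem lie_eq_zero_of_isSimpleIdealOf {h₁ h₂ D : LieSubalgebra ℝ L} (s₁ : IsSimpleIdealOf h₁ D)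
    (s₂ : IsSimpleIdealOf h₂ D) (hne : h₁ ≠ h₂) {X Y : L} (hX : X ∈ h₁) (hY : Y ∈ h₂) :
    ⁅X, Y⁆ = 0 := by
  by_contra h0
  have m2 : ⁅X, Y⁆ ∈ h₂ := s₂.2.1 X (s₁.1 hX) Y hY
  have m1 : ⁅X, Y⁆ ∈ h₁ := by
    rw [← lie_skew]
    exact neg_mem (s₁.2.1 Y (s₂.1 hY) X hX)
  refine hne (le_antisymm ?_ ?_)
  · exact le_of_isSimple_of_stable s₁.2.2 h₂.toSubmodule
      (fun A hA B _ hB => s₂.2.1 A (s₁.1 hA) B hB) ⟨_, m1, m2, h0⟩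
  · exact le_of_isSimple_of_stable s₂.2.2 h₁.toSubmodule
      (fun A hA B _ hB => s₁.2.1 A (s₂.1 hA) B hB) ⟨_, m2, m1, h0⟩

/-- By invariance `B([A, A'], Y) = B(A, [A', Y]) = 0`, so the orthogonal of `Y` contains all
brackets of `h₁`, hence `h₁` by simplicity. -/
theorem killingForm_eq_zero_of_isSimpleIdealOf {h₁ h₂ D : LieSubalgebra ℝ L}
    (s₁ : IsSimpleIdealOf h₁ D) (s₂ : IsSimpleIdealOf h₂ D) (hne : h₁ ≠ h₂) {X Y : L}
    (hX : X ∈ h₁) (hY : Y ∈ h₂) : killingForm ℝ L X Y = 0 := by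
  have hc : ∀ A ∈ h₁, ∀ A' ∈ h₁, killingForm ℝ L ⁅A, A'⁆ Y = 0 := by
    intro A _ A' hA'
    rw [killingForm_lie, lie_eq_zero_of_isSimpleIdealOf s₁ s₂ hne hA' hY, map_zero]
  obtain ⟨A, hA, A', hA', h0⟩ := exists_lie_ne_zero_of_isSimple s₁.2.2
  refine le_of_isSimple_of_stable s₁.2.2 (LinearMap.ker ((killingForm ℝ L).flip Y))
    (fun B hB B' hB' _ => ?_) ⟨_, h₁.lie_mem hA hA', ?_, h0⟩ hX
  · exact hc B hB B' hB'
  · exact hc A hA A' hA'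

end LieSimple

/-! ### Structure of `k` and the ratios `κ_i`. -/

section CompactPart

variable {L : Type*} [LieRing L] [LieAlgebra ℝ L] {k : LieSubalgebra ℝ L} {p : Submodule ℝ L}

theorem derivedSub_le (k : LieSubalgebra ℝ L) : derivedSub k ≤ k := by
  rintro _ ⟨x, -, rfl⟩
  exact x.2

theorem lie_mem_derivedSub {X Y : L} (hX : X ∈ k) (hY : Y ∈ k) : ⁅X, Y⁆ ∈ derivedSub k :=
  ⟨⁅(⟨X, hX⟩ : k), (⟨Y, hY⟩ : k)⁆,
    LieSubmodule.lie_mem_lie (LieSubmodule.mem_top (R := ℝ) (L := k) (⟨X, hX⟩ : k))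
      (LieSubmodule.mem_top (R := ℝ) (L := k) (⟨Y, hY⟩ : k)), rfl⟩

theorem derivedSub_le_submodule {W : Submodule ℝ L} (hW : ∀ X ∈ k, ∀ Y ∈ k, ⁅X, Y⁆ ∈ W) :
    (derivedSub k).toSubmodule ≤ W := by
  rintro _ ⟨x, hx, rfl⟩
  have hx' : x ∈ (⁅(⊤ : LieIdeal ℝ k), (⊤ : LieIdeal ℝ k)⁆ : LieIdeal ℝ k).toSubmodule := hx
  rw [LieSubmodule.lieIdeal_oper_eq_linear_span] at hx'
  have : Submodule.span ℝ {x : k | ∃ (a : (⊤ : LieIdeal ℝ k)) (b : (⊤ : LieIdeal ℝ k)),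
      ⁅(a : k), (b : k)⁆ = x} ≤ W.comap k.toSubmodule.subtype := by
    rw [Submodule.span_le]
    rintro _ ⟨a, b, rfl⟩
    exact hW _ (a : k).2 _ (b : k).2
  exact this hx'

theorem mem_centerSub_iff {X : L} : X ∈ centerSub k ↔ X ∈ k ∧ ∀ Y ∈ k, ⁅Y, X⁆ = 0 := by
  constructor
  · rintro ⟨x, hx, rfl⟩
    refine ⟨x.2, fun Y hY => ?_⟩
    exact congrArg Subtype.val ((LieModule.mem_maxTrivSubmodule ℝ k k x).1 hx ⟨Y, hY⟩)
  · rintro ⟨hX, h⟩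
    exact ⟨⟨X, hX⟩, (LieModule.mem_maxTrivSubmodule ℝ k k _).2
      fun Y => Subtype.ext (h Y Y.2), rfl⟩

theorem IsCartanDecomposition.eq_zero (h : IsCartanDecomposition k p) {X : L} (hX : X ∈ k)
    (h0 : killingForm ℝ L X X = 0) : X = 0 := by
  by_contra hne
  exact (h.neg X hX hne).ne h0

/-- An element of `k` orthogonal to `[k, k]` is central in `k`. -/
theorem IsCartanDecomposition.lie_eq_zero_of_orthogonal (h : IsCartanDecomposition k p) {X : L}
    (hX : X ∈ k) (ho : ∀ Y ∈ derivedSub k, killingForm ℝ L X Y = 0) {Y : L} (hY : Y ∈ k) :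
    ⁅Y, X⁆ = 0 := by
  rw [← lie_skew, neg_eq_zero]
  refine h.eq_zero (k.lie_mem hX hY) ?_
  rw [killingForm_lie]
  exact ho _ (lie_mem_derivedSub hY (k.lie_mem hX hY))

theorem killingForm_derivedSub_of_central {X : L} (hX : ∀ Y ∈ k, ⁅Y, X⁆ = 0) {Y : L}
    (hY : Y ∈ derivedSub k) : killingForm ℝ L X Y = 0 := by
  have : (derivedSub k).toSubmodule ≤ LinearMap.ker (killingForm ℝ L X) :=
    derivedSub_le_submodule fun A hA B _ => by
      rw [LinearMap.mem_ker, ← killingForm_lie, ← lie_skew, hX A hA, neg_zero, map_zero,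
        LinearMap.zero_apply]
  exact this hY

/-- `B` is invariant and definite on `[k, k]`, so it remains to exclude abelian minimal ideals. For
`x` in one, `[x, [x, y]] = 0` gives `B([x, y], [x, y]) = 0`, so `x` commutes with `[k, k]`; the same
trick shows it commutes with `k`. Being central and in `[k, k]`, it is orthogonal to itself. -/
theorem IsCartanDecomposition.isSemisimple_derivedSub [FiniteDimensional ℝ L]
    (h : IsCartanDecomposition k p) : LieAlgebra.IsSemisimple ℝ (derivedSub k) := by
  let Φ : LinearMap.BilinForm ℝ (derivedSub k) :=
    (killingForm ℝ L).compl₁₂ (derivedSub k).toSubmodule.subtype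
      (derivedSub k).toSubmodule.subtype
  have hΦ : ∀ x y : derivedSub k, Φ x y = killingForm ℝ L x y := fun _ _ => rfl
  have hdef : ∀ x : derivedSub k, Φ x x = 0 → x = 0 := fun x hx =>
    Subtype.ext (h.eq_zero (derivedSub_le k x.2) hx)
  have hsymm : ∀ x y, Φ x y = Φ y x := fun x y => killingForm_symm (x : L) (y : L)
  refine LieAlgebra.InvariantForm.isSemisimple_of_nondegenerate Φ
    ⟨fun x hx => hdef x (hx x), fun x hx => hdef x (hx x)⟩ (fun x y z => ?_)
    (fun x y hxy => by rw [hsymm, hxy]) (fun I hI hab => ?_)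
  · change killingForm ℝ L ⁅(x : L), (y : L)⁆ z = -killingForm ℝ L (y : L) ⁅(x : L), (z : L)⁆
    rw [← lie_skew, map_neg, LinearMap.neg_apply, killingForm_lie]
  · refine hI.1 (eq_bot_iff.2 fun x hx => ?_)
    rw [LieSubmodule.mem_bot]
    have hxk : (x : L) ∈ k := derivedSub_le k x.2
    have hD : ∀ y : derivedSub k, ⁅x, y⁆ = 0 := by
      intro y
      apply hdef
      have hxy : ⁅x, y⁆ ∈ I := lie_mem_left ℝ _ I x y hx
      have h2 : ⁅x, ⁅x, y⁆⁆ = 0 :=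
        congrArg Subtype.val (hab.trivial (⟨x, hx⟩ : I) (⟨⁅x, y⁆, hxy⟩ : I))
      have h2' : ⁅(x : L), ⁅(x : L), (y : L)⁆⁆ = 0 := congrArg Subtype.val h2
      have hgen : ∀ W : L, ⁅(x : L), W⁆ = 0 → killingForm ℝ L ⁅(x : L), (y : L)⁆ W = 0 := by
        intro W hW
        rw [← lie_skew, map_neg, LinearMap.neg_apply, killingForm_lie, hW, map_zero, neg_zero]
      exact hgen _ h2'
    have hk : ∀ Z ∈ k, ⁅Z, (x : L)⁆ = 0 := by
      intro Z hZ
      apply h.eq_zero (k.lie_mem hZ hxk)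
      have h1 : ⁅(x : L), ⁅Z, (x : L)⁆⁆ = 0 :=
        congrArg Subtype.val (hD ⟨⁅Z, (x : L)⁆, lie_mem_derivedSub hZ hxk⟩)
      rw [killingForm_lie, h1, map_zero]
    exact hdef x (killingForm_derivedSub_of_central hk x.2)

/-- `[k, k]` is spanned by its simple ideals. -/
theorem IsCartanDecomposition.derivedSub_le_of_isSimpleIdealOf [FiniteDimensional ℝ L]
    (h : IsCartanDecomposition k p) {W : Submodule ℝ L}
    (hW : ∀ a : LieSubalgebra ℝ L, IsSimpleIdealOf a (derivedSub k) → a.toSubmodule ≤ W) :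
    (derivedSub k).toSubmodule ≤ W := by
  have hss := h.isSemisimple_derivedSub
  have hatom : ∀ J : LieIdeal ℝ (derivedSub k), IsAtom J →
      J.toSubmodule ≤ W.comap (derivedSub k).toSubmodule.subtype := by
    intro J hJ
    -- `IsSimpleIdealOf` concerns subalgebras of `L`, so the minimal ideal is pushed forward into
    -- `L`.
    let f : J →ₗ⁅ℝ⁆ L := (derivedSub k).incl.comp J.incl
    have hf : Function.Injective f := fun x y hxy => Subtype.ext (Subtype.ext hxy)
    have hs : IsSimpleIdealOf f.range (derivedSub k) := by
      refine ⟨?_, ?_, isSimple_of_lieEquiv (LieEquiv.ofInjective f hf)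
        (hss.isSimple_of_isAtom J hJ)⟩
      · rintro _ ⟨x, rfl⟩
        exact (x : derivedSub k).2
      · rintro X hX _ ⟨y, rfl⟩
        exact ⟨⟨⁅(⟨X, hX⟩ : derivedSub k), (y : derivedSub k)⁆, J.lie_mem y.2⟩, rfl⟩
    intro x hx
    exact hW _ hs ⟨⟨x, hx⟩, rfl⟩
  have htop : (⊤ : LieIdeal ℝ (derivedSub k)).toSubmodule ≤
      W.comap (derivedSub k).toSubmodule.subtype := by
    rw [← hss.sSup_atoms_eq_top, LieSubmodule.sSup_toSubmodule]
    refine sSup_le ?_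
    rintro _ ⟨J, hJ, rfl⟩
    exact hatom J hJ
  intro X hX
  exact htop (LieSubmodule.mem_top (⟨X, hX⟩ : derivedSub k))

section StandardIdeals

variable {r s : ℕ} {kk : Fin (r + s) → LieSubalgebra ℝ L}

theorem IsStandardIdeals.isSimpleIdealOf (hkk : IsStandardIdeals k r s kk) (i : Fin r) :
    IsSimpleIdealOf (kk (Fin.castAdd s i)) (derivedSub k) :=
  (hkk.simple_iff _).2 ⟨i, rfl⟩

theorem IsStandardIdeals.le (hkk : IsStandardIdeals k r s kk) (i : Fin (r + s)) : kk i ≤ k := by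
  induction i using Fin.addCases with
  | left i => exact (hkk.isSimpleIdealOf i).1.trans (derivedSub_le k)
  | right j =>
    rw [hkk.center]
    exact fun X hX => (mem_centerSub_iff.1 hX).1

theorem IsStandardIdeals.lie_and_killingForm_eq_zero (hkk : IsStandardIdeals k r s kk)
    {i j : Fin (r + s)} (hij : i ≠ j) {X Y : L} (hX : X ∈ kk i) (hY : Y ∈ kk j) :
    ⁅X, Y⁆ = 0 ∧ killingForm ℝ L X Y = 0 := by
  induction i using Fin.addCases with
  | left i =>
    induction j using Fin.addCases with
    | left j =>
      have hne : kk (Fin.castAdd s i) ≠ kk (Fin.castAdd s j) := by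
        intro h
        exact hij (congrArg _ (hkk.injective h))
      exact ⟨lie_eq_zero_of_isSimpleIdealOf (hkk.isSimpleIdealOf i) (hkk.isSimpleIdealOf j)
        hne hX hY,
        killingForm_eq_zero_of_isSimpleIdealOf (hkk.isSimpleIdealOf i) (hkk.isSimpleIdealOf j)
          hne hX hY⟩
    | right j =>
      rw [hkk.center, mem_centerSub_iff] at hY
      refine ⟨hY.2 X (hkk.le _ hX), ?_⟩
      rw [killingForm_symm]
      exact killingForm_derivedSub_of_central hY.2 ((hkk.isSimpleIdealOf i).1 hX)
  | right i =>
    rw [hkk.center, mem_centerSub_iff] at hX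
    induction j using Fin.addCases with
    | left j =>
      refine ⟨?_, killingForm_derivedSub_of_central hX.2 ((hkk.isSimpleIdealOf j).1 hY)⟩
      rw [← lie_skew, hX.2 Y (hkk.le _ hY), neg_zero]
    | right j =>
      exfalso
      -- There is at most one central index, so two distinct ones cannot occur.
      have hs : s ≤ 1 := by rcases hkk.card_center with h | h <;> omega
      have h1 := i.2
      have h2 := j.2
      exact hij (congrArg _ (Fin.ext (by omega)))

theorem IsStandardIdeals.exists_ne_zero (hkk : IsStandardIdeals k r s kk) (i : Fin (r + s)) :
    ∃ X ∈ kk i, X ≠ 0 := by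
  induction i using Fin.addCases with
  | left i =>
    obtain ⟨X, hX, Y, hY, h0⟩ := exists_lie_ne_zero_of_isSimple (hkk.isSimpleIdealOf i).2.2
    exact ⟨_, LieSubalgebra.lie_mem _ hX hY, h0⟩
  | right j =>
    rw [hkk.center]
    have hne : centerSub k ≠ ⊥ := by
      rcases hkk.card_center with h | h
      · exact absurd j.2 (by omega)
      · exact h.1
    by_contra! hc
    exact hne (eq_bot_iff.2 fun X hX => by simpa using hc X hX)

/-- `k` is spanned by its standard ideals. -/
theorem IsStandardIdeals.le_of_forall_le [FiniteDimensional ℝ L] (hkk : IsStandardIdeals k r s kk)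
    (h : IsCartanDecomposition k p) {W : Submodule ℝ L} (hW : ∀ i, (kk i).toSubmodule ≤ W) :
    k.toSubmodule ≤ W := by
  let U : Submodule ℝ L := ⨆ i, (kk i).toSubmodule
  have hUk : U ≤ k.toSubmodule := iSup_le fun i => hkk.le i
  suffices hU : k.toSubmodule ≤ U from hU.trans (iSup_le hW)
  -- Definiteness of `B` on `U` splits `L` as `U` plus its orthogonal. The orthogonal part `w` of an
  -- element of `k` is orthogonal to `[k, k] ≤ U`, hence central in `k`, hence already in `U`.
  have hnd : ((killingForm ℝ L).restrict U).Nondegenerate := by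
    have : ∀ x : U, killingForm ℝ L (x : L) x = 0 → x = 0 := fun x hx =>
      Subtype.ext (h.eq_zero (hUk x.2) hx)
    exact ⟨fun x hx => this x (hx x), fun x hx => this x (hx x)⟩
  have hc := LinearMap.BilinForm.isCompl_orthogonal_of_restrict_nondegenerate
    (B := killingForm ℝ L) (W := U) (fun x y hxy => by rw [killingForm_symm, hxy]) hnd
  intro X hX
  obtain ⟨u, hu, w, hw, rfl⟩ := Submodule.mem_sup.1
    (hc.sup_eq_top ▸ Submodule.mem_top : X ∈ U ⊔ (killingForm ℝ L).orthogonal U)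
  rw [LinearMap.BilinForm.mem_orthogonal_iff] at hw
  have hwk : w ∈ k := by
    have := sub_mem hX (hUk hu)
    rwa [add_sub_cancel_left] at this
  have hDU : (derivedSub k).toSubmodule ≤ U := h.derivedSub_le_of_isSimpleIdealOf fun a ha => by
    obtain ⟨i, rfl⟩ := (hkk.simple_iff a).1 ha
    exact le_iSup (fun i => (kk i).toSubmodule) (Fin.castAdd s i)
  have hwc : w ∈ centerSub k := mem_centerSub_iff.2 ⟨hwk, fun Y hY =>
    h.lie_eq_zero_of_orthogonal hwk (fun Z hZ => by
      rw [killingForm_symm]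
      exact hw Z (hDU hZ)) hY⟩
  have hwU : w ∈ U := by
    rcases hkk.card_center with hs | hs
    · rw [hs.1] at hwc
      rw [(LieSubalgebra.mem_bot w).1 hwc]
      exact zero_mem U
    · have hj : (kk (Fin.natAdd r ⟨0, by omega⟩)).toSubmodule ≤ U :=
        le_iSup (fun i => (kk i).toSubmodule) _
      rw [hkk.center] at hj
      exact hj hwc
  exact add_mem hu hwU

end StandardIdeals

/-- A simple subalgebra on which the ambient Killing form is negative definite has its own
Killing form proportional to it. -/
theorem exists_isKillingRatio_of_isSimple [FiniteDimensional ℝ L] {a : LieSubalgebra ℝ L}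
    (hs : LieAlgebra.IsSimple ℝ a) (hneg : ∀ X ∈ a, X ≠ 0 → killingForm ℝ L X X < 0) :
    ∃ c, IsKillingRatio a c := by
  let b : a →ₗ[ℝ] a →ₗ[ℝ] ℝ :=
    (killingForm ℝ L).compl₁₂ a.toSubmodule.subtype a.toSubmodule.subtype
  have hb : ∀ x y : a, b x y = killingForm ℝ L x y := fun _ _ => rfl
  obtain ⟨z, hz⟩ := exists_isSignedBasis_of_definite b
    (fun v w => killingForm_symm (v : L) (w : L)) (-1) (by norm_num)
    (fun v hv => by
      rw [neg_one_mul, neg_pos]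
      exact hneg v v.2 (fun h0 => hv (Subtype.ext h0)))
  obtain ⟨X₀, hX₀, Y₀, hY₀, hne⟩ := exists_lie_ne_zero_of_isSimple hs
  have : Nontrivial a := ⟨⟨⟨_, a.lie_mem hX₀ hY₀⟩, 0, fun h0 => hne (congrArg Subtype.val h0)⟩⟩
  have hpos : 0 < Module.finrank ℝ a := Module.finrank_pos
  let A : Matrix (Fin (Module.finrank ℝ a)) (Fin (Module.finrank ℝ a)) ℝ :=
    Matrix.of fun i j => killingForm ℝ a (z i) (z j)
  have hA : A.IsHermitian := by
    ext i j
    simp only [A, Matrix.conjTranspose_apply, Matrix.of_apply, star_trivial]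
    exact killingForm_symm _ _
  let j₀ : Fin (Module.finrank ℝ a) := ⟨0, hpos⟩
  have hev := hA.mulVec_eigenvectorBasis j₀
  let v : Fin (Module.finrank ℝ a) → ℝ := (hA.eigenvectorBasis j₀).ofLp
  have hv0 : v ≠ 0 := by
    intro h0
    have h1 := hA.eigenvectorBasis.orthonormal.1 j₀
    have h2 : hA.eigenvectorBasis j₀ = 0 := by
      ext i
      exact congrFun h0 i
    rw [h2, norm_zero] at h1
    exact zero_ne_one h1
  let lam := hA.eigenvalues j₀
  let X : a := ∑ i, v i • z i
  have hX0 : X ≠ 0 := by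
    intro h0
    apply hv0
    funext i
    rw [← hz.apply_sum v i]
    change -1 * b X (z i) = 0
    rw [h0, map_zero, LinearMap.zero_apply, mul_zero]
  -- An eigenvector of the Gram matrix in the basis `z` gives a non-zero element of this kernel; the
  -- sign appears because `b` is minus the identity in that basis. Invariance of both forms makes
  -- the kernel an ideal.
  let J : Submodule ℝ a := LinearMap.ker (killingForm ℝ a - (-lam) • b)
  have hJ : ∀ x : a, x ∈ J ↔ ∀ y, killingForm ℝ a x y = -lam * b x y := by
    intro x
    rw [LinearMap.mem_ker, LinearMap.ext_iff]
    refine forall_congr' fun y => ?_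
    rw [LinearMap.sub_apply, LinearMap.sub_apply, LinearMap.smul_apply, LinearMap.smul_apply,
      LinearMap.zero_apply, sub_eq_zero, smul_eq_mul]
  have hXJ : X ∈ J := by
    rw [LinearMap.mem_ker]
    refine hz.toBasis.ext fun i => ?_
    rw [hz.toBasis_apply, LinearMap.sub_apply, LinearMap.smul_apply, LinearMap.sub_apply,
      LinearMap.smul_apply, LinearMap.zero_apply, sub_eq_zero, smul_eq_mul]
    have h1 : killingForm ℝ a X (z i) = lam * v i := by
      have h2 := congrFun hev i
      rw [killingForm_symm]
      simp only [X, map_sum, map_smul, smul_eq_mul]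
      rw [Pi.smul_apply, smul_eq_mul] at h2
      rw [show lam * v i = _ from h2.symm, Matrix.mulVec, dotProduct]
      exact Finset.sum_congr rfl fun j _ => mul_comm _ _
    have h3 : -1 * b X (z i) = v i := hz.apply_sum v i
    rw [h1, ← h3]
    ring
  have hstable : ∀ x y : a, y ∈ J → ⁅x, y⁆ ∈ J := by
    intro x y hy
    rw [hJ] at hy ⊢
    intro w
    rw [← lie_skew, map_neg, map_neg, LinearMap.neg_apply, LinearMap.neg_apply, killingForm_lie,
      hy, hb, hb]
    have : killingForm ℝ L ((⁅y, x⁆ : a) : L) w = killingForm ℝ L y ((⁅x, w⁆ : a) : L) :=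
      killingForm_lie (y : L) (x : L) (w : L)
    rw [this]
    ring
  let J' : LieIdeal ℝ a := { J with lie_mem := fun {x y} hy => hstable x y hy }
  have htop : J' = ⊤ := by
    refine (hs.eq_bot_or_eq_top J').resolve_left fun h0 => hX0 ?_
    have : X ∈ J' := hXJ
    rwa [h0, LieSubmodule.mem_bot] at this
  refine ⟨-lam, fun x y => ?_⟩
  have : x ∈ J' := htop ▸ LieSubmodule.mem_top x
  exact (hJ x).1 this y

theorem killingForm_eq_zero_of_abelian {a : LieSubalgebra ℝ L}
    (ha : ∀ X ∈ a, ∀ Y ∈ a, ⁅X, Y⁆ = 0) (X Y : a) : killingForm ℝ a X Y = 0 := by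
  rw [LieModule.traceForm_apply_apply]
  have : LieModule.toEnd ℝ a a X = 0 := by
    ext Z
    exact ha X X.2 Z Z.2
  rw [this, LinearMap.zero_comp, map_zero]

theorem IsStandardIdeals.isKillingRatio_center {r s : ℕ} {kk : Fin (r + s) → LieSubalgebra ℝ L}
    (hkk : IsStandardIdeals k r s kk) (j : Fin s) : IsKillingRatio (kk (Fin.natAdd r j)) 0 := by
  intro X Y
  rw [zero_mul]
  refine killingForm_eq_zero_of_abelian (fun A hA B hB => ?_) X Y
  have h1 := hkk.le _ hA
  rw [hkk.center, mem_centerSub_iff] at hB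
  exact hB.2 A h1

theorem IsStandardIdeals.existsUnique_isKillingRatio [FiniteDimensional ℝ L] {r s : ℕ}
    {kk : Fin (r + s) → LieSubalgebra ℝ L} (hkk : IsStandardIdeals k r s kk)
    (h : IsCartanDecomposition k p) (i : Fin (r + s)) : ∃! c : ℝ, IsKillingRatio (kk i) c := by
  have hex : ∃ c : ℝ, IsKillingRatio (kk i) c := by
    induction i using Fin.addCases with
    | left i =>
      exact exists_isKillingRatio_of_isSimple (hkk.isSimpleIdealOf i).2.2
        fun X hX => h.neg X (hkk.le _ hX)
    | right j => exact ⟨0, hkk.isKillingRatio_center j⟩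
  obtain ⟨c, hc⟩ := hex
  refine ⟨c, hc, fun c' hc' => ?_⟩
  obtain ⟨X, hX, hX0⟩ := hkk.exists_ne_zero i
  have h1 := hc ⟨X, hX⟩ ⟨X, hX⟩
  rw [hc' ⟨X, hX⟩ ⟨X, hX⟩] at h1
  exact mul_right_cancel₀ (h.neg X (hkk.le _ hX) hX0).ne h1

end CompactPart

/-! ### Sums over symmetric arrays of Cartan type. -/

section WeightedSums

variable {P J : Type*} {K : J → Type*} [Fintype P] [Fintype J] [∀ i, Fintype (K i)]

/-- A totally symmetric array on `P ⊕ Σ i, K i` that is supported on triples of type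
`(P, P, K i)` and `(K i, K i, K i)`. -/
structure IsCartanArray (T : P ⊕ (Σ i, K i) → P ⊕ (Σ i, K i) → P ⊕ (Σ i, K i) → ℝ) : Prop where
  swap : ∀ a b c, T a b c = T b a c
  cycle : ∀ a b c, T a b c = T b c a
  ppp : ∀ a b c, T (.inl a) (.inl b) (.inl c) = 0
  kkp : ∀ a b c, T (.inr a) (.inr b) (.inl c) = 0
  kkk : ∀ a b c, ¬ (a.1 = b.1 ∧ a.1 = c.1) → T (.inr a) (.inr b) (.inr c) = 0

variable {T : P ⊕ (Σ i, K i) → P ⊕ (Σ i, K i) → P ⊕ (Σ i, K i) → ℝ}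

theorem sum_sigma_eq_single (i : J) (f : (Σ i, K i) → ℝ) (hf : ∀ q, q.1 ≠ i → f q = 0) :
    ∑ q, f q = ∑ a : K i, f ⟨i, a⟩ := by
  classical
  rw [Fintype.sum_sigma]
  refine Finset.sum_eq_single i (fun j _ hj => Finset.sum_eq_zero fun b _ => hf _ hj) ?_
  simp

theorem IsCartanArray.pkp (hT : IsCartanArray T) (a c : P) (q : Σ i, K i) :
    T (.inl a) (.inr q) (.inl c) = T (.inr q) (.inl a) (.inl c) := hT.swap _ _ _

theorem IsCartanArray.ppk (hT : IsCartanArray T) (a c : P) (q : Σ i, K i) :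
    T (.inl a) (.inl c) (.inr q) = T (.inr q) (.inl a) (.inl c) := (hT.cycle _ _ _).symm

theorem IsCartanArray.pkk (hT : IsCartanArray T) (a : P) (q q' : Σ i, K i) :
    T (.inl a) (.inr q) (.inr q') = 0 := by rw [hT.cycle, hT.kkp]

theorem IsCartanArray.kpk (hT : IsCartanArray T) (a : P) (q q' : Σ i, K i) :
    T (.inr q) (.inl a) (.inr q') = 0 := by rw [hT.swap, hT.pkk]

/-- Summing over the last two indices, the first one lying in `K i`. -/
theorem IsCartanArray.sum_k (hT : IsCartanArray T) (W : P ⊕ (Σ i, K i) → P ⊕ (Σ i, K i) → ℝ)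
    (i : J) (a : K i) :
    ∑ b, ∑ c, W b c * T (.inr ⟨i, a⟩) b c =
      ∑ b, ∑ c, W (.inl b) (.inl c) * T (.inr ⟨i, a⟩) (.inl b) (.inl c)
      + ∑ b : K i, ∑ c : K i, W (.inr ⟨i, b⟩) (.inr ⟨i, c⟩) *
          T (.inr ⟨i, a⟩) (.inr ⟨i, b⟩) (.inr ⟨i, c⟩) := by
  simp only [Fintype.sum_sum_type, hT.kpk, hT.kkp, mul_zero, Finset.sum_const_zero, add_zero,
    zero_add]
  congr 1
  rw [sum_sigma_eq_single i _ (fun q hq => Finset.sum_eq_zero fun c _ => by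
    rw [hT.kkk _ _ _ (fun h => hq h.1.symm), mul_zero])]
  refine Finset.sum_congr rfl fun b _ => ?_
  exact sum_sigma_eq_single i _ (fun q hq => by
    rw [hT.kkk _ _ _ (fun h => hq h.2.symm), mul_zero])

/-- Summing over the last two indices, the first one lying in `P`. -/
theorem IsCartanArray.sum_p (hT : IsCartanArray T) (W : P ⊕ (Σ i, K i) → P ⊕ (Σ i, K i) → ℝ)
    (a : P) :
    ∑ b, ∑ c, W b c * T (.inl a) b c =
      ∑ q, ∑ b, (W (.inl b) (.inr q) + W (.inr q) (.inl b)) * T (.inr q) (.inl a) (.inl b) := by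
  simp only [Fintype.sum_sum_type, hT.ppp, hT.pkk, hT.ppk, hT.pkp, mul_zero, Finset.sum_const_zero,
    add_zero, zero_add, add_mul, Finset.sum_add_distrib]
  rw [add_comm]
  congr 1
  rw [Finset.sum_comm]

end WeightedSums

/-! ### Adapted bases, Killing trace identities and the dimension formula. -/

section AdaptedBasis

variable {L : Type*} [LieRing L] [LieAlgebra ℝ L] {k : LieSubalgebra ℝ L} {p : Submodule ℝ L}

/-- The Killing form of the ambient Lie algebra, restricted to a subspace. -/
noncomputable def killingFormOn (W : Submodule ℝ L) : W →ₗ[ℝ] W →ₗ[ℝ] ℝ :=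
  (killingForm ℝ L).compl₁₂ W.subtype W.subtype

theorem killingFormOn_apply (W : Submodule ℝ L) (x y : W) :
    killingFormOn W x y = killingForm ℝ L x y := rfl

theorem killingForm_lie_lie (X Y Z : L) :
    killingForm ℝ L ⁅X, Y⁆ Z = -killingForm ℝ L ⁅X, Z⁆ Y := by
  rw [← lie_skew, map_neg, LinearMap.neg_apply, killingForm_lie, killingForm_symm]

theorem killingForm_lie_cycle (X Y Z : L) :
    killingForm ℝ L ⁅X, Y⁆ Z = killingForm ℝ L ⁅Y, Z⁆ X := by
  rw [killingForm_lie, killingForm_symm]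

variable {m : ℕ} {kk : Fin m → LieSubalgebra ℝ L}

/-- The family formed by vectors of `p` and of the ideals `kk i`. -/
def adaptedFamily (y : Fin (Module.finrank ℝ p) → p)
    (x : ∀ i, Fin (Module.finrank ℝ (kk i)) → kk i) :
    Fin (Module.finrank ℝ p) ⊕ (Σ i, Fin (Module.finrank ℝ (kk i))) → L :=
  Sum.elim (fun b => (y b : L)) (fun q => (x q.1 q.2 : L))

theorem adaptedFamily_inl (y : Fin (Module.finrank ℝ p) → p)
    (x : ∀ i, Fin (Module.finrank ℝ (kk i)) → kk i) (b : Fin (Module.finrank ℝ p)) :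
    adaptedFamily y x (.inl b) = y b := rfl

theorem adaptedFamily_inr (y : Fin (Module.finrank ℝ p) → p)
    (x : ∀ i, Fin (Module.finrank ℝ (kk i)) → kk i) (q : Σ i, Fin (Module.finrank ℝ (kk i))) :
    adaptedFamily y x (.inr q) = x q.1 q.2 := rfl

/-- The signs of an adapted family. -/
def adaptedSign : Fin (Module.finrank ℝ p) ⊕ (Σ i, Fin (Module.finrank ℝ (kk i))) → ℝ :=
  Sum.elim (fun _ => 1) (fun _ => -1)

theorem isSignedBasis_adaptedFamily [FiniteDimensional ℝ L] (h : IsCartanDecomposition k p)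
    (hle : ∀ i, kk i ≤ k)
    (horth : ∀ i j, i ≠ j → ∀ X ∈ kk i, ∀ Y ∈ kk j, killingForm ℝ L X Y = 0)
    (hspan : ∀ W : Submodule ℝ L, (∀ i, (kk i).toSubmodule ≤ W) → k.toSubmodule ≤ W)
    {y : Fin (Module.finrank ℝ p) → p} (hy : IsSignedBasis (killingFormOn p) y (fun _ => 1))
    {x : ∀ i, Fin (Module.finrank ℝ (kk i)) → kk i}
    (hx : ∀ i, IsSignedBasis (killingFormOn (kk i).toSubmodule) (x i) (fun _ => -1)) :
    IsSignedBasis (killingForm ℝ L) (adaptedFamily y x) adaptedSign := by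
  have horthz : ∀ a b, killingForm ℝ L (adaptedFamily y x a) (adaptedFamily y x b) =
      if a = b then adaptedSign a else 0 := by
    rintro (a | ⟨i, a⟩) (b | ⟨j, b⟩)
    · rw [show killingForm ℝ L (adaptedFamily y x (.inl a)) (adaptedFamily y x (.inl b)) = _ from
        hy.orthogonal a b]
      simp [adaptedSign]
    · rw [if_neg (by simp)]
      exact (h.mem_p_iff _).1 (y a).2 _ (hle j (x j b).2)
    · rw [if_neg (by simp), killingForm_symm]
      exact (h.mem_p_iff _).1 (y b).2 _ (hle i (x i a).2)
    · by_cases hij : i = j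
      · subst hij
        rw [show killingForm ℝ L (adaptedFamily y x (.inr ⟨i, a⟩)) (adaptedFamily y x (.inr ⟨i, b⟩))
          = _ from (hx i).orthogonal a b]
        simp [adaptedSign]
      · rw [if_neg (by simp [hij])]
        exact horth i j hij _ (x i a).2 _ (x j b).2
  have hsq : ∀ a, adaptedSign (p := p) (kk := kk) a * adaptedSign a = 1 := by
    rintro (a | a) <;> simp [adaptedSign]
  refine ⟨horthz, hsq, ?_⟩
  -- `S` is the expansion operator. It fixes each basis vector, hence `p` and every `kk i`, which
  -- together span.
  let S : L →ₗ[ℝ] L := ∑ i, (adaptedSign (p := p) (kk := kk) i •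
    (killingForm ℝ L).flip (adaptedFamily y x i)).smulRight (adaptedFamily y x i)
  have hS : ∀ v, S v = ∑ i, (adaptedSign (p := p) (kk := kk) i *
      killingForm ℝ L v (adaptedFamily y x i)) • adaptedFamily y x i := by
    intro v
    simp [S]
  have hSz : ∀ a, S (adaptedFamily y x a) = adaptedFamily y x a := by
    intro a
    rw [hS]
    simp [horthz, hsq]
  let W : Submodule ℝ L := LinearMap.ker (S - LinearMap.id)
  have hW : ∀ v, v ∈ W ↔ S v = v := by
    intro v
    rw [LinearMap.mem_ker, LinearMap.sub_apply, LinearMap.id_apply, sub_eq_zero]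
  have hp : p ≤ W := by
    intro v hv
    have := congrArg Subtype.val (hy.expansion ⟨v, hv⟩)
    rw [AddSubmonoidClass.coe_finsetSum] at this
    rw [show v = _ from this]
    refine Submodule.sum_mem _ fun i _ => ?_
    exact W.smul_mem _ ((hW _).2 (hSz (.inl i)))
  have hk : k.toSubmodule ≤ W := hspan W fun i v hv => by
    have := congrArg Subtype.val ((hx i).expansion ⟨v, hv⟩)
    rw [AddSubmonoidClass.coe_finsetSum] at this
    rw [show v = _ from this]
    refine Submodule.sum_mem _ fun a _ => ?_
    exact W.smul_mem _ ((hW _).2 (hSz (.inr ⟨i, a⟩)))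
  have htop : ⊤ ≤ W := h.isCompl.sup_eq_top ▸ sup_le hp hk
  intro v
  rw [← hS]
  exact ((hW v).1 (htop Submodule.mem_top)).symm

/-- The squares of the structure constants of a family of vectors. -/
noncomputable def structureSquare {ι : Type*} (z : ι → L) (a b c : ι) : ℝ :=
  killingForm ℝ L ⁅z a, z b⁆ (z c) ^ 2

/-- Squaring removes the signs of the alternating form `B([X, Y], Z)`. The vanishing comes from `[p,
p] ⊆ k`, `[k, k] ⊆ k`, `B(p, k) = 0` and the commutation of distinct ideals. -/
theorem isCartanArray_adaptedFamily (h : IsCartanDecomposition k p)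
    (hle : ∀ i, kk i ≤ k)
    (hcomm : ∀ i j, i ≠ j → ∀ X ∈ kk i, ∀ Y ∈ kk j, ⁅X, Y⁆ = 0)
    (y : Fin (Module.finrank ℝ p) → p) (x : ∀ i, Fin (Module.finrank ℝ (kk i)) → kk i) :
    IsCartanArray (structureSquare (adaptedFamily y x)) where
  swap a b c := by
    rw [structureSquare, structureSquare, ← lie_skew, map_neg, LinearMap.neg_apply, neg_sq]
  cycle a b c := by rw [structureSquare, structureSquare, killingForm_lie_cycle]
  ppp a b c := by
    rw [structureSquare, killingForm_symm, adaptedFamily_inl, adaptedFamily_inl, adaptedFamily_inl,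
      (h.mem_p_iff _).1 (y c).2 _ (h.lie_mem _ (y a).2 _ (y b).2), zero_pow two_ne_zero]
  kkp a b c := by
    rw [structureSquare, killingForm_symm, adaptedFamily_inl, adaptedFamily_inr, adaptedFamily_inr,
      (h.mem_p_iff _).1 (y c).2 _ (k.lie_mem (hle _ (x a.1 a.2).2) (hle _ (x b.1 b.2).2)),
      zero_pow two_ne_zero]
  kkk a b c hne := by
    refine pow_eq_zero_iff two_ne_zero |>.2 ?_
    rw [adaptedFamily_inr, adaptedFamily_inr, adaptedFamily_inr]
    by_cases hab : a.1 = b.1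
    · have hac : a.1 ≠ c.1 := fun hac => hne ⟨hab, hac⟩
      rw [killingForm_lie_cycle, hcomm _ _ (fun hbc => hac (hab.trans hbc)) _ (x b.1 b.2).2 _
        (x c.1 c.2).2, map_zero, LinearMap.zero_apply]
    · rw [hcomm _ _ hab _ (x a.1 a.2).2 _ (x b.1 b.2).2, map_zero, LinearMap.zero_apply]

/-- The Killing form of a Lie algebra in terms of structure constants with respect to a signed
basis for an invariant form. -/
theorem IsSignedBasis.killingForm_eq {A ι : Type*} [LieRing A] [LieAlgebra ℝ A] [Fintype ι]
    [DecidableEq ι] {b : A →ₗ[ℝ] A →ₗ[ℝ] ℝ} {z : ι → A} {ε : ι → ℝ} (hz : IsSignedBasis b z ε)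
    (hb : ∀ X Y Z : A, b ⁅X, Y⁆ Z = -b ⁅X, Z⁆ Y) (X : A) :
    killingForm ℝ A X X = -∑ i, ∑ j, ε i * ε j * b ⁅X, z i⁆ (z j) ^ 2 := by
  rw [LieModule.traceForm_apply_apply, hz.trace_eq, ← Finset.sum_neg_distrib]
  refine Finset.sum_congr rfl fun i _ => ?_
  change ε i * b ⁅X, ⁅X, z i⁆⁆ (z i) = _
  rw [hb, hz.bilin_eq]
  simp only [Finset.mul_sum, ← Finset.sum_neg_distrib]
  refine Finset.sum_congr rfl fun j _ => ?_
  ring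

/-- An orthonormal basis adapted to a Cartan decomposition and to ideals of `k`. -/
structure IsAdaptedBasis (y : Fin (Module.finrank ℝ p) → p)
    (x : ∀ i, Fin (Module.finrank ℝ (kk i)) → kk i) : Prop where
  full : IsSignedBasis (killingForm ℝ L) (adaptedFamily y x) adaptedSign
  ideal : ∀ i, IsSignedBasis (killingFormOn (kk i).toSubmodule) (x i) (fun _ => -1)
  array : IsCartanArray (structureSquare (adaptedFamily y x))

theorem IsStandardIdeals.exists_isAdaptedBasis [FiniteDimensional ℝ L] {r s : ℕ}
    {kk : Fin (r + s) → LieSubalgebra ℝ L} (hkk : IsStandardIdeals k r s kk)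
    (h : IsCartanDecomposition k p) :
    ∃ (y : Fin (Module.finrank ℝ p) → p) (x : ∀ i, Fin (Module.finrank ℝ (kk i)) → kk i),
      IsAdaptedBasis y x := by
  obtain ⟨y, hy⟩ := exists_isSignedBasis_of_definite (killingFormOn p)
    (fun v w => killingForm_symm (v : L) (w : L)) 1 (by norm_num)
    (fun v hv => by
      rw [one_mul]
      exact h.pos v v.2 (fun h0 => hv (Subtype.ext h0)))
  have hx : ∀ i, ∃ x : Fin (Module.finrank ℝ (kk i)) → kk i,
      IsSignedBasis (killingFormOn (kk i).toSubmodule) x (fun _ => -1) := fun i =>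
    exists_isSignedBasis_of_definite (killingFormOn (kk i).toSubmodule)
      (fun v w => killingForm_symm (v : L) (w : L)) (-1) (by norm_num)
      (fun v hv => by
        rw [neg_one_mul, neg_pos]
        exact h.neg v (hkk.le i v.2) (fun h0 => hv (Subtype.ext h0)))
  choose x hx using hx
  exact ⟨y, x, isSignedBasis_adaptedFamily h hkk.le
      (fun i j hij X hX Y hY => (hkk.lie_and_killingForm_eq_zero hij hX hY).2)
      (fun W hW => hkk.le_of_forall_le h hW) hy hx,
    hx, isCartanArray_adaptedFamily h hkk.le
      (fun i j hij X hX Y hY => (hkk.lie_and_killingForm_eq_zero hij hX hY).1) y x⟩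

section

variable {y : Fin (Module.finrank ℝ p) → p} {x : ∀ i, Fin (Module.finrank ℝ (kk i)) → kk i}

/-- Compares the two values of `B(z_a, z_a)`: the sign `ε_a`, and the trace of `(ad z_a)²`. -/
theorem IsAdaptedBasis.sum_structureSquare (hb : IsAdaptedBasis y x)
    (a : Fin (Module.finrank ℝ p) ⊕ (Σ i, Fin (Module.finrank ℝ (kk i)))) :
    ∑ b, ∑ c, adaptedSign b * adaptedSign c * structureSquare (adaptedFamily y x) a b c =
      -adaptedSign a := by
  have h1 := hb.full.killingForm_eq killingForm_lie_lie (adaptedFamily y x a)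
  rw [hb.full.orthogonal, if_pos rfl] at h1
  rw [h1, neg_neg]
  rfl

theorem IsAdaptedBasis.sum_ideal (hb : IsAdaptedBasis y x) {i : Fin m} {κ : ℝ}
    (hκ : IsKillingRatio (kk i) κ) (a : Fin (Module.finrank ℝ (kk i))) :
    ∑ b, ∑ c, structureSquare (adaptedFamily y x) (.inr ⟨i, a⟩) (.inr ⟨i, b⟩) (.inr ⟨i, c⟩) =
      κ := by
  have h1 := (hb.ideal i).killingForm_eq (A := kk i)
    (fun X Y Z => killingForm_lie_lie (X : L) (Y : L) (Z : L)) (x i a)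
  rw [hκ, ← killingFormOn_apply (kk i).toSubmodule (x i a) (x i a), (hb.ideal i).orthogonal,
    if_pos rfl, mul_neg_one, neg_inj] at h1
  rw [h1]
  refine Finset.sum_congr rfl fun b _ => Finset.sum_congr rfl fun c _ => ?_
  rw [neg_mul_neg, one_mul, one_mul]
  rfl

/-- The full trace for a vector of `k_i` is `1`, and its part inside `k_i` is `κ`. -/
theorem IsAdaptedBasis.sum_complement (hb : IsAdaptedBasis y x) {i : Fin m} {κ : ℝ}
    (hκ : IsKillingRatio (kk i) κ) (a : Fin (Module.finrank ℝ (kk i))) :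
    ∑ b, ∑ c, structureSquare (adaptedFamily y x) (.inr ⟨i, a⟩) (.inl b) (.inl c) = 1 - κ := by
  have h1 := hb.sum_structureSquare (.inr ⟨i, a⟩)
  rw [hb.array.sum_k (fun b c => adaptedSign b * adaptedSign c)] at h1
  simp only [adaptedSign, Sum.elim_inl, Sum.elim_inr, one_mul, neg_mul_neg, neg_neg,
    hb.sum_ideal hκ a] at h1
  linarith

theorem IsAdaptedBasis.sum_complement_dim (hb : IsAdaptedBasis y x) {κ : Fin m → ℝ}
    (hκ : ∀ i, IsKillingRatio (kk i) (κ i)) (w : Fin m → ℝ) :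
    ∑ q : (Σ i, Fin (Module.finrank ℝ (kk i))), ∑ b, ∑ c, w q.1 *
        structureSquare (adaptedFamily y x) (.inr q) (.inl b) (.inl c) =
      ∑ i, w i * ((Module.finrank ℝ (kk i) : ℝ) * (1 - κ i)) := by
  rw [Fintype.sum_sigma]
  refine Finset.sum_congr rfl fun i _ => ?_
  simp only [← Finset.mul_sum, hb.sum_complement (hκ i)]
  rw [Finset.sum_const, Finset.card_univ, Fintype.card_fin, nsmul_eq_mul]

/-- The dimension formula relating the Killing forms of the ideals to the dimension of `p`. -/
theorem IsAdaptedBasis.dim_formula (hb : IsAdaptedBasis y x) {κ : Fin m → ℝ}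
    (hκ : ∀ i, IsKillingRatio (kk i) (κ i)) :
    2 * ∑ i, (Module.finrank ℝ (kk i) : ℝ) * (1 - κ i) = (Module.finrank ℝ p : ℝ) := by
  -- The factor `2` counts the placements `(p, k)` and `(k, p)` of the other two indices, both with
  -- sign `-1`.
  have h1 : ∀ b : Fin (Module.finrank ℝ p), ∑ q, ∑ c, 2 *
      structureSquare (adaptedFamily y x) (.inr q) (.inl b) (.inl c) = 1 := by
    intro b
    have h2 := hb.sum_structureSquare (.inl b)
    rw [hb.array.sum_p (fun b c => adaptedSign b * adaptedSign c)] at h2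
    simp only [adaptedSign, Sum.elim_inl, Sum.elim_inr, one_mul, mul_one] at h2
    rw [← neg_inj, ← h2]
    simp only [← Finset.sum_neg_distrib]
    refine Finset.sum_congr rfl fun q _ => Finset.sum_congr rfl fun c _ => ?_
    ring
  have h3 := hb.sum_complement_dim hκ (fun _ => 2)
  rw [← Finset.mul_sum] at h3
  rw [← h3, Finset.sum_comm]
  simp only [h1]
  simp

end

end AdaptedBasis

/-! ### The block metric and its algebraic scalar curvature. -/

section BlockMetric

variable {L : Type*} [LieRing L] [LieAlgebra ℝ L] {k : LieSubalgebra ℝ L} {p : Submodule ℝ L}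

theorem cartanForm_of_mem_p (h : IsCartanDecomposition k p) {X Y : L} (hX : X ∈ p) (hY : Y ∈ p) :
    cartanForm h X Y = killingForm ℝ L X Y := by
  have h1 : ∀ {Z : L} (hZ : Z ∈ p), p.projectionOnto k.toSubmodule h.isCompl Z = ⟨Z, hZ⟩ :=
    fun {Z} hZ => Submodule.projectionOnto_apply_left h.isCompl ⟨Z, hZ⟩
  have h2 : ∀ {Z : L} (_ : Z ∈ p), k.toSubmodule.projectionOnto p h.isCompl.symm Z = 0 :=
    fun {Z} hZ => (Submodule.projectionOnto_apply_eq_zero_iff h.isCompl.symm).2 hZ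
  rw [cartanForm, h1 hX, h1 hY, h2 hX, h2 hY]
  simp

theorem cartanForm_of_mem_k (h : IsCartanDecomposition k p) {X Y : L} (hX : X ∈ k) (hY : Y ∈ k) :
    cartanForm h X Y = -killingForm ℝ L X Y := by
  have h1 : ∀ {Z : L} (_ : Z ∈ k), p.projectionOnto k.toSubmodule h.isCompl Z = 0 :=
    fun {Z} hZ => (Submodule.projectionOnto_apply_eq_zero_iff h.isCompl).2 hZ
  have h2 : ∀ {Z : L} (hZ : Z ∈ k),
      k.toSubmodule.projectionOnto p h.isCompl.symm Z = ⟨Z, hZ⟩ :=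
    fun {Z} hZ => Submodule.projectionOnto_apply_left h.isCompl.symm ⟨Z, hZ⟩
  rw [cartanForm, h1 hX, h1 hY, h2 hX, h2 hY]
  simp

variable {m : ℕ} {kk : Fin m → LieSubalgebra ℝ L}
  {y : Fin (Module.finrank ℝ p) → p} {x : ∀ i, Fin (Module.finrank ℝ (kk i)) → kk i}

/-- The squared lengths of an adapted basis for a block metric. -/
def blockWeight (β : ℝ) (α : Fin m → ℝ) :
    Fin (Module.finrank ℝ p) ⊕ (Σ i, Fin (Module.finrank ℝ (kk i))) → ℝ :=
  Sum.elim (fun _ => β) (fun q => α q.1)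

theorem blockWeight_pos {β : ℝ} {α : Fin m → ℝ} (hβ : 0 < β) (hα : ∀ i, 0 < α i)
    (a : Fin (Module.finrank ℝ p) ⊕ (Σ i, Fin (Module.finrank ℝ (kk i)))) :
    0 < blockWeight β α a := by
  rcases a with a | a
  · exact hβ
  · exact hα a.1

/-- The adapted basis diagonalises both forms, so pairing with a basis vector differs only by the
ratio of the diagonal entries. -/
theorem IsAdaptedBasis.block_apply (hb : IsAdaptedBasis y x) (h : IsCartanDecomposition k p)
    (hle : ∀ i, kk i ≤ k) {β : ℝ} {α : Fin m → ℝ} {b : L →ₗ[ℝ] L →ₗ[ℝ] ℝ}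
    (hsymm : ∀ X Y, b X Y = b Y X) (hB : IsBlockForm h kk β α (fun X Y => b X Y))
    (X : L) (c : Fin (Module.finrank ℝ p) ⊕ (Σ i, Fin (Module.finrank ℝ (kk i)))) :
    b X (adaptedFamily y x c) =
      blockWeight β α c * adaptedSign c * killingForm ℝ L X (adaptedFamily y x c) := by
  have hz : ∀ a, b (adaptedFamily y x a) (adaptedFamily y x c) =
      blockWeight β α c * adaptedSign c *
        killingForm ℝ L (adaptedFamily y x a) (adaptedFamily y x c) := by
    intro a
    rcases a with a | ⟨i, a⟩ <;> rcases c with c | ⟨j, c⟩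
    · change b (y a : L) (y c : L) = β * 1 * killingForm ℝ L (y a : L) (y c : L)
      rw [← cartanForm_of_mem_p h (y a).2 (y c).2, mul_one]
      exact hB.on_p _ (y a).2 _ (y c).2
    · rw [hb.full.orthogonal, if_neg (by simp), mul_zero]
      exact hB.p_k j _ (y a).2 _ (x j c).2
    · rw [hb.full.orthogonal, if_neg (by simp), mul_zero, hsymm]
      exact hB.p_k i _ (y c).2 _ (x i a).2
    · by_cases hij : i = j
      · subst hij
        change b (x i a : L) (x i c : L) = α i * -1 * killingForm ℝ L (x i a : L) (x i c : L)
        rw [mul_assoc, neg_one_mul,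
          ← cartanForm_of_mem_k h (hle i (x i a).2) (hle i (x i c).2)]
        exact hB.on_k i _ (x i a).2 _ (x i c).2
      · rw [hb.full.orthogonal, if_neg (by simp [hij]), mul_zero]
        exact hB.k_k i j hij _ (x i a).2 _ (x j c).2
  rw [hb.full.expansion X, map_sum, map_sum, LinearMap.sum_apply, LinearMap.sum_apply,
    Finset.mul_sum]
  refine Finset.sum_congr rfl fun a _ => ?_
  rw [map_smul, map_smul, LinearMap.smul_apply, LinearMap.smul_apply, hz, smul_eq_mul, smul_eq_mul]
  ring

/-- Sum of the squared structure constants of an orthonormal basis for a block metric. -/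
theorem IsAdaptedBasis.sum_weighted (hb : IsAdaptedBasis y x) {β : ℝ} {α κ : Fin m → ℝ}
    (hβ : 0 < β) (hα : ∀ i, 0 < α i) (hκ : ∀ i, IsKillingRatio (kk i) (κ i)) :
    ∑ a, ∑ b, ∑ c, blockWeight β α c / (blockWeight β α a * blockWeight β α b) *
        structureSquare (adaptedFamily y x) a b c =
      ∑ i, (α i / β ^ 2 + 2 / α i) * ((Module.finrank ℝ (kk i) : ℝ) * (1 - κ i))
      + ∑ i, (Module.finrank ℝ (kk i) : ℝ) * κ i / α i := by
  -- Type `(p, p, k_i)` has weight `α i / β ^ 2` and type `(p, k_i, p)` weight `1 / α i`; type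
  -- `(k_i, p, p)`, in `hk`, supplies the second `1 / α i`.
  have hp : ∀ a, ∑ b, ∑ c, blockWeight (p := p) (kk := kk) β α c /
        (blockWeight (p := p) (kk := kk) β α (.inl a) * blockWeight β α b) *
        structureSquare (adaptedFamily y x) (.inl a) b c =
      ∑ q : (Σ i, Fin (Module.finrank ℝ (kk i))), ∑ b, (α q.1 / β ^ 2 + 1 / α q.1) *
        structureSquare (adaptedFamily y x) (.inr q) (.inl a) (.inl b) := by
    intro a
    rw [hb.array.sum_p (fun b c => blockWeight β α c /
      (blockWeight (p := p) (kk := kk) β α (.inl a) * blockWeight β α b))]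
    refine Finset.sum_congr rfl fun q _ => Finset.sum_congr rfl fun b _ => ?_
    congr 1
    have := (hα q.1).ne'
    simp only [blockWeight, Sum.elim_inl, Sum.elim_inr]
    field_simp
  have hk : ∀ i a, ∑ b, ∑ c, blockWeight β α c /
        (blockWeight (p := p) (kk := kk) β α (.inr ⟨i, a⟩) * blockWeight β α b) *
        structureSquare (adaptedFamily y x) (.inr ⟨i, a⟩) b c =
      1 / α i * (1 - κ i) + 1 / α i * κ i := by
    intro i a
    rw [hb.array.sum_k (fun b c => blockWeight β α c /
      (blockWeight (p := p) (kk := kk) β α (.inr ⟨i, a⟩) * blockWeight β α b))]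
    rw [← hb.sum_complement (hκ i) a]
    conv_rhs => rw [← hb.sum_ideal (hκ i) a]
    simp only [blockWeight, Sum.elim_inl, Sum.elim_inr, Finset.mul_sum]
    have := (hα i).ne'
    congr 1
    · refine Finset.sum_congr rfl fun b _ => Finset.sum_congr rfl fun c _ => ?_
      congr 1
      field_simp
    · refine Finset.sum_congr rfl fun b _ => Finset.sum_congr rfl fun c _ => ?_
      congr 1
      field_simp
  rw [Fintype.sum_sum_type, Fintype.sum_sigma]
  simp only [hp, hk, Finset.sum_const, Finset.card_univ, Fintype.card_fin, nsmul_eq_mul]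
  rw [Finset.sum_comm, hb.sum_complement_dim hκ (fun i => α i / β ^ 2 + 1 / α i),
    ← Finset.sum_add_distrib, ← Finset.sum_add_distrib]
  refine Finset.sum_congr rfl fun i _ => ?_
  ring

/-- The algebraic scalar curvature of a block metric. -/
theorem IsAdaptedBasis.exists_orthonormal_basis (hb : IsAdaptedBasis y x)
    (h : IsCartanDecomposition k p) (hle : ∀ i, kk i ≤ k) {β : ℝ} {α κ : Fin m → ℝ}
    (hβ : 0 < β) (hα : ∀ i, 0 < α i) (hκ : ∀ i, IsKillingRatio (kk i) (κ i))
    {b : L →ₗ[ℝ] L →ₗ[ℝ] ℝ} (hsymm : ∀ X Y, b X Y = b Y X)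
    (hB : IsBlockForm h kk β α (fun X Y => b X Y)) :
    ∃ e : Fin (Module.finrank ℝ p) ⊕ (Σ i, Fin (Module.finrank ℝ (kk i))) → L,
      (∀ i j, b (e i) (e j) = if i = j then 1 else 0) ∧ (∀ j, ∑ i, b ⁅e j, e i⁆ (e i) = 0) ∧
      -(1 / 4) * ∑ i, ∑ j, ∑ l, b ⁅e i, e j⁆ (e l) ^ 2
        - 1 / 2 * ∑ i, ∑ j, ∑ l, b ⁅e i, e j⁆ (e l) * b ⁅e i, e l⁆ (e j) =
      -(1 / 4) * ∑ i, α i / β ^ 2 * (Module.finrank ℝ (kk i) : ℝ) * (1 - κ i)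
        - (Module.finrank ℝ p : ℝ) / (2 * β)
        + (1 / 4) * ∑ i, (Module.finrank ℝ (kk i) : ℝ) * κ i / α i := by
  let z := adaptedFamily y x
  let w := blockWeight (p := p) (kk := kk) β α
  let t := fun a => Real.sqrt (w a)
  have ht : ∀ a, t a ≠ 0 := fun a => (Real.sqrt_pos.2 (blockWeight_pos hβ hα a)).ne'
  have hw : ∀ a, w a = t a ^ 2 := fun a => (Real.sq_sqrt (blockWeight_pos hβ hα a).le).symm
  have hbz : ∀ X c, b X (z c) = t c ^ 2 * adaptedSign c * killingForm ℝ L X (z c) := by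
    intro X c
    rw [← hw]
    exact hb.block_apply h hle hsymm hB X c
  let e := fun a => (t a)⁻¹ • z a
  have hC : ∀ i j l, b ⁅e i, e j⁆ (e l) = (t i)⁻¹ * (t j)⁻¹ * t l * adaptedSign l *
      killingForm ℝ L ⁅z i, z j⁆ (z l) := by
    intro i j l
    simp only [e, smul_lie, lie_smul, map_smul, LinearMap.smul_apply, smul_eq_mul, hbz]
    have := ht l
    field_simp
  have hsq : ∀ a, adaptedSign (p := p) (kk := kk) a ^ 2 = 1 := fun a => by
    rw [sq]; exact hb.full.sq a
  refine ⟨e, fun i j => ?_, fun j => Finset.sum_eq_zero fun i _ => ?_, ?_⟩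
  · simp only [e, map_smul, LinearMap.smul_apply, smul_eq_mul, hbz]
    rw [hb.full.orthogonal]
    split_ifs with hij
    · subst hij
      have h1 := ht i
      have h2 := hsq i
      field_simp
      exact h2
    · simp
  · rw [hC, killingForm_lie, lie_self, map_zero, mul_zero]
  · have h1 : ∑ i, ∑ j, ∑ l, b ⁅e i, e j⁆ (e l) ^ 2 =
        ∑ i, (α i / β ^ 2 + 2 / α i) * ((Module.finrank ℝ (kk i) : ℝ) * (1 - κ i))
        + ∑ i, (Module.finrank ℝ (kk i) : ℝ) * κ i / α i := by
      rw [← hb.sum_weighted hβ hα hκ]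
      refine Finset.sum_congr rfl fun i _ => Finset.sum_congr rfl fun j _ =>
        Finset.sum_congr rfl fun l _ => ?_
      change _ = w l / (w i * w j) * killingForm ℝ L ⁅z i, z j⁆ (z l) ^ 2
      rw [hC, hw, hw, hw, mul_pow, mul_pow, hsq]
      have := ht i
      have := ht j
      field_simp
    -- Exchanging `j` and `l` inverts their weights, so only `1 / w i` remains and the inner sum is
    -- the Killing trace again.
    have h2 : ∑ i, ∑ j, ∑ l, b ⁅e i, e j⁆ (e l) * b ⁅e i, e l⁆ (e j) =
        (Module.finrank ℝ p : ℝ) / β - ∑ i, (Module.finrank ℝ (kk i) : ℝ) / α i := by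
      have h3 : ∀ i, ∑ j, ∑ l, b ⁅e i, e j⁆ (e l) * b ⁅e i, e l⁆ (e j) =
          adaptedSign i / w i := by
        intro i
        have h4 : adaptedSign i / w i = -(w i)⁻¹ * -adaptedSign i := by
          rw [div_eq_mul_inv]; ring
        rw [h4, ← hb.sum_structureSquare i, Finset.mul_sum]
        refine Finset.sum_congr rfl fun j _ => ?_
        rw [Finset.mul_sum]
        refine Finset.sum_congr rfl fun l _ => ?_
        change _ = -(w i)⁻¹ * (adaptedSign j * adaptedSign l *
          killingForm ℝ L ⁅z i, z j⁆ (z l) ^ 2)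
        rw [hC, hC, hw, killingForm_lie_lie (z i) (z l) (z j)]
        have := ht i
        have := ht j
        have := ht l
        field_simp
      rw [Finset.sum_congr rfl fun i _ => h3 i, Fintype.sum_sum_type, Fintype.sum_sigma]
      simp [w, blockWeight, adaptedSign, div_eq_mul_inv, sub_eq_add_neg]
    -- Isolates `∑ d_i / α_i`, which cancels against `h2`, and leaves `∑ d_i κ_i / α_i` with
    -- coefficient `-1/4 * (1 - 2) = 1/4`.
    have h5 : ∑ i, (α i / β ^ 2 + 2 / α i) * ((Module.finrank ℝ (kk i) : ℝ) * (1 - κ i)) =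
        ∑ i, α i / β ^ 2 * (Module.finrank ℝ (kk i) : ℝ) * (1 - κ i)
        + 2 * ∑ i, (Module.finrank ℝ (kk i) : ℝ) / α i
        - 2 * ∑ i, (Module.finrank ℝ (kk i) : ℝ) * κ i / α i := by
      rw [Finset.mul_sum, Finset.mul_sum, ← Finset.sum_add_distrib, ← Finset.sum_sub_distrib]
      refine Finset.sum_congr rfl fun i _ => ?_
      ring
    rw [h1, h2, h5, mul_comm 2 β, ← div_div]
    ring

end BlockMetric

theorem mainTheorem9
    {E : Type*} [NormedAddCommGroup E] [NormedSpace ℝ E] [FiniteDimensional ℝ E]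
    {G : Type*} [TopologicalSpace G] [ChartedSpace E G] [Group G] [LieGroup 𝓘(ℝ, E) ∞ G]
    [ConnectedSpace G] [NoncompactSpace G]
    [LieAlgebra.IsSimple ℝ (GroupLieAlgebra 𝓘(ℝ, E) G)]
    (k : LieSubalgebra ℝ (GroupLieAlgebra 𝓘(ℝ, E) G))
    (p : Submodule ℝ (GroupLieAlgebra 𝓘(ℝ, E) G))
    (hkp : IsCartanDecomposition k p)
    (r s : ℕ) (kk : Fin (r + s) → LieSubalgebra ℝ (GroupLieAlgebra 𝓘(ℝ, E) G))
    (hkk : IsStandardIdeals k r s kk) :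
    (∀ i, ∃! c : ℝ, IsKillingRatio (kk i) c) ∧
    ∀ κ : Fin (r + s) → ℝ, (∀ i, IsKillingRatio (kk i) (κ i)) →
      2 * ∑ i, (Module.finrank ℝ (kk i) : ℝ) * (1 - κ i) = (Module.finrank ℝ p : ℝ) ∧
      ∀ (β : ℝ) (α : Fin (r + s) → ℝ), 0 < β → (∀ i, 0 < α i) →
      ∀ g : Bundle.ContMDiffRiemannianMetric 𝓘(ℝ, E) ∞ E
          (TangentSpace 𝓘(ℝ, E) : G → Type _),
        IsLeftInvariantMetric g →
        IsBlockForm hkp kk β α (fun X Y => g.inner (1 : G) X Y) →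
        ∀ x : G, HasScalarCurvatureAt g x
          (-(1 / 4) * ∑ i, α i / β ^ 2 * (Module.finrank ℝ (kk i) : ℝ) * (1 - κ i)
            - (Module.finrank ℝ p : ℝ) / (2 * β)
            + (1 / 4) * ∑ i : Fin r, (Module.finrank ℝ (kk (Fin.castAdd s i)) : ℝ)
                * κ (Fin.castAdd s i) / α (Fin.castAdd s i)) := by
  have : FiniteDimensional ℝ (GroupLieAlgebra 𝓘(ℝ, E) G) :=
    inferInstanceAs (FiniteDimensional ℝ E)
  have huniq := hkk.existsUnique_isKillingRatio hkp
  obtain ⟨y, x, hb⟩ := hkk.exists_isAdaptedBasis hkp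
  refine ⟨huniq, fun κ hκ => ⟨hb.dim_formula hκ, fun β α hβ hα g hg hB x₀ => ?_⟩⟩
  let b : GroupLieAlgebra 𝓘(ℝ, E) G →ₗ[ℝ] GroupLieAlgebra 𝓘(ℝ, E) G →ₗ[ℝ] ℝ :=
    LinearMap.mk₂ ℝ (fun u v => g.inner 1 u v) (by intros; simp) (by intros; simp)
      (by intros; simp) (by intros; simp)
  obtain ⟨e, he, hU, hS⟩ := hb.exists_orthonormal_basis hkp hkk.le hβ hα hκ (b := b)
    (fun X Y => g.symm 1 X Y) hB
  have hF := isHomogeneousFrame_mulInvariantVectorField hg he hb.full.card_eq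
  have hmain := hF.hasScalarCurvatureAt hb.full.card_eq hU x₀
  -- The centre has ratio `0`, so the last sum may run over the simple ideals only.
  have hκ0 : ∑ i : Fin s, (Module.finrank ℝ (kk (Fin.natAdd r i)) : ℝ)
      * κ (Fin.natAdd r i) / α (Fin.natAdd r i) = 0 := by
    refine Finset.sum_eq_zero fun j _ => ?_
    rw [(huniq (Fin.natAdd r j)).unique (hκ _) (hkk.isKillingRatio_center j), mul_zero, zero_div]
  have hsum := Fin.sum_univ_add (fun i : Fin (r + s) =>
    (Module.finrank ℝ (kk i) : ℝ) * κ i / α i)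
  rw [hκ0, add_zero] at hsum
  rw [← hsum, ← hS]
  exact hmain
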